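/- A $d$-polytope is a $d$-dimensional convex hull of finitely many points in some $\mathbb{R}^n$; it is \emph{cubical} if the face lattice of each of its facets is isomorphic to the face lattice of a $(d-1)$-cube. A $4$-polytope $P$ is \emph{strongly $2$-linked} if its graph $G(P)$ (formed by the vertices and edges of $P$) has at least five vertices and, for every set $X$ of exactly five vertices of $P$ and every choice of two disjoint pairs $\{s_1,t_1\}$, $\{s_2,t_2\}$ of vertices in $X$, there are vertex-disjoint paths $L_1$ from $s_1$ to $t_1$ and $L_2$ from $s_2$ to $t_2$ in $G(P)$ that both avoid the fifth vertex of $X$. **Theorem (Strong linkedness of cubical 4-polytopes).** Every cubical $4$-polytope is strongly $2$-linked. Moreover, this fails for general $4$-polytopes: let a \emph{pyramid} over a polytope $Q$ be the convex hull of $Q$ and a point outside the affine hull of $Q$, let a \emph{two-fold pyramid} over $Q$ be a pyramid over a pyramid over $Q$, and let a \emph{quadrangle} be a $2$-polytope with four vertices. Then two-fold pyramids over quadrangles exist in $\mathbb{R}^4$, and every two-fold pyramid over a quadrangle is a $4$-polytope with six vertices that is not strongly $2$-linked. -/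

import Mathlib

namespace CubicalPolytope

/-- A (convex) polytope: the convex hull of finitely many points. -/
def IsPolytope {n : ℕ} (P : Set (EuclideanSpace ℝ (Fin n))) : Prop :=
  ∃ S : Finset (EuclideanSpace ℝ (Fin n)), P = convexHull ℝ (S : Set (EuclideanSpace ℝ (Fin n)))

/-- A nonempty set `P` has dimension `d` if its affine hull has dimension `d`. -/
def HasDim {n : ℕ} (d : ℕ) (P : Set (EuclideanSpace ℝ (Fin n))) : Prop :=
  P.Nonempty ∧ Module.finrank ℝ (vectorSpan ℝ P) = d

/-- A `d`-polytope is a polytope of dimension `d`. -/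
def IsDPolytope {n : ℕ} (d : ℕ) (P : Set (EuclideanSpace ℝ (Fin n))) : Prop :=
  IsPolytope P ∧ HasDim d P

/-- The faces of a polytope `P`, ordered by inclusion: the empty set and the sets of points of `P`
at which some linear functional attains its maximum over `P` (the zero functional gives `P`). -/
abbrev Face {n : ℕ} (P : Set (EuclideanSpace ℝ (Fin n))) : Type :=
  {F : Set (EuclideanSpace ℝ (Fin n)) // IsExposed ℝ P F}

/-- Combinatorial equivalence: the face lattices are isomorphic. -/
def CombEquiv {m n : ℕ} (P : Set (EuclideanSpace ℝ (Fin m)))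
    (Q : Set (EuclideanSpace ℝ (Fin n))) : Prop :=
  Nonempty (Face P ≃o Face Q)

/-- The standard cube `[0,1]^d`. -/
def stdCube (d : ℕ) : Set (EuclideanSpace ℝ (Fin d)) :=
  {x | ∀ i, 0 ≤ x i ∧ x i ≤ 1}

/-- A facet of a `d`-polytope is a face of dimension `d - 1`. A cubical `d`-polytope is a
`d`-polytope all of whose facets are combinatorially equivalent to the `(d - 1)`-cube. -/
def IsCubicalDPolytope {n : ℕ} (d : ℕ) (P : Set (EuclideanSpace ℝ (Fin n))) : Prop :=
  IsDPolytope d P ∧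
    ∀ F : Set (EuclideanSpace ℝ (Fin n)), IsExposed ℝ P F →
      ∀ e : ℕ, e + 1 = d → HasDim e F → CombEquiv F (stdCube e)

/-- The vertices of `P`: the points `v` such that `{v}` is a face of `P`. -/
abbrev vertexSet {n : ℕ} (P : Set (EuclideanSpace ℝ (Fin n))) :
    Set (EuclideanSpace ℝ (Fin n)) :=
  P.exposedPoints ℝ

/-- The graph of `P`: two distinct vertices are adjacent when the segment that joins them is a face
(an edge) of `P`. -/
def polytopeGraph {n : ℕ} (P : Set (EuclideanSpace ℝ (Fin n))) :
    SimpleGraph (vertexSet P) where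
  Adj u v := u ≠ v ∧ IsExposed ℝ P
    (segment ℝ (u : EuclideanSpace ℝ (Fin n)) (v : EuclideanSpace ℝ (Fin n)))
  symm := ⟨fun u v h => ⟨h.1.symm, by rw [segment_symm]; exact h.2⟩⟩
  loopless := ⟨fun _ h => h.1 rfl⟩

/-- For a `d`-polytope `P` and `k = ⌊(d + 1) / 2⌋`: `P` is strongly `k`-linked. The graph of `P` has
at least `d + 1` vertices and, for every set `X` of exactly `d + 1` vertices and every choice of `k`
disjoint pairs `{s i, t i}` in `X`, there are pairwise vertex-disjoint paths from `s i` to `t i`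
which avoid the vertices of `X` that are not paired. -/
def IsStronglyLinked {n : ℕ} (d k : ℕ) (P : Set (EuclideanSpace ℝ (Fin n))) : Prop :=
  ((d + 1 : ℕ) : ℕ∞) ≤ (vertexSet P).encard ∧
  ∀ X : Finset (vertexSet P), X.card = d + 1 →
    ∀ s t : Fin k → vertexSet P,
      Function.Injective (Sum.elim s t) → (∀ i, s i ∈ X) → (∀ i, t i ∈ X) →
      ∃ L : ∀ i, (polytopeGraph P).Path (s i) (t i),
        (∀ i j, i ≠ j → ∀ v, v ∈ (L i).1.support → v ∉ (L j).1.support) ∧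
        ∀ x ∈ X, (∀ i, x ≠ s i ∧ x ≠ t i) → ∀ i, x ∉ (L i).1.support

/-- A quadrangle: a 2-polytope with four vertices. -/
def IsQuadrangle {n : ℕ} (Q : Set (EuclideanSpace ℝ (Fin n))) : Prop :=
  IsDPolytope 2 Q ∧ (vertexSet Q).encard = 4

/-- `P` is a pyramid over `Q`: the convex hull of `Q` and a point outside the affine hull of `Q`. -/
def IsPyramid {n : ℕ} (P Q : Set (EuclideanSpace ℝ (Fin n))) : Prop :=
  ∃ a, a ∉ affineSpan ℝ Q ∧ P = convexHull ℝ (insert a Q)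

/-- `P` is a two-fold pyramid over `Q`: a pyramid over a pyramid over `Q`. -/
def IsTwoFoldPyramid {n : ℕ} (P Q : Set (EuclideanSpace ℝ (Fin n))) : Prop :=
  ∃ R, IsPyramid R Q ∧ IsPyramid P R

end CubicalPolytope

/-! A polytope is replaced by a finite set `V` in convex position, and its faces by the exposed
subsets of `V`; vertices, edges and paths then become statements about finitely many linear
inequalities.

The routing tool is the edge step of the simplex method: a vertex that does not maximise `f` has an
edge along which `f` increases (`InConvexPosition.exists_edge`). So two vertices in a closed
half-space can be joined through the open half-space, as soon as that contains a vertex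
(`InConvexPosition.joinedWithin_halfSpace`).

Let `x` be the vertex to avoid. The functionals that are constant on `x, s, t`, up to constants and
restricted to the directions of the 4-polytope, form a 2-dimensional space `W`. If no nonzero
element of `W` supports the polytope at `x, s, t`, choose one that takes the same value at `s'` as
at `x`, with the sign that puts `t'` on the closed upper side. Both open sides contain vertices, so
`s, t` are joined below and `s', t'` above, and `x` stays on the hyperplane. If some element does
support it, rotating the hyperplane about the plane of `x, s, t` gives a facet through these three
vertices (`InConvexPosition.exists_halfSpace_or_facet`). This facet is a 3-cube: one pair is joined
inside it, away from `x` and the other pair, and the other pair is joined outside it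
(`InConvexPosition.linkedAvoiding_of_facet`).

For the counterexample, Radon's theorem makes the diagonals of the quadrangle cross, so neither is
an edge of the two-fold pyramid. When one apex is forbidden, each path between opposite corners must
use the other apex, so the two paths meet. -/

namespace CubicalPolytope

/-! ### Faces of a convex hull as exposed subsets of a finite set. -/

section ExposedSubset

variable {E : Type*} [NormedAddCommGroup E] [NormedSpace ℝ E]

/-- `T` is the set of points of `V` at which some linear functional attains a given upper bound
on `V`. -/
def IsExposedSubset (V T : Finset E) : Prop :=
  T ⊆ V ∧ ∃ (l : E →L[ℝ] ℝ) (c : ℝ), (∀ v ∈ T, l v = c) ∧ ∀ v ∈ V, v ∉ T → l v < c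

/-- Every point of `V` is a vertex of the convex hull of `V`. -/
def InConvexPosition (V : Finset E) : Prop :=
  ∀ v ∈ V, IsExposedSubset V {v}

lemma IsExposedSubset.refl (V : Finset E) : IsExposedSubset V V :=
  ⟨subset_rfl, 0, 0, by simp, fun v hv h => absurd hv h⟩

lemma le_of_mem_convexHull {V : Finset E} {l : E →L[ℝ] ℝ} {c : ℝ} (h : ∀ v ∈ V, l v ≤ c)
    {x : E} (hx : x ∈ convexHull ℝ (V : Set E)) : l x ≤ c :=
  convexHull_min (t := {y | l y ≤ c}) (fun v hv => h v hv)
    (convex_halfSpace_le l.toLinearMap.isLinear c) hx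

lemma eq_of_mem_convexHull {V : Finset E} {l : E →L[ℝ] ℝ} {c : ℝ} (h : ∀ v ∈ V, l v = c)
    {x : E} (hx : x ∈ convexHull ℝ (V : Set E)) : l x = c :=
  convexHull_min (t := {y | l y = c}) (fun v hv => h v hv)
    (convex_hyperplane l.toLinearMap.isLinear c) hx

/-- The face of a convex hull on which a functional is maximal is spanned by points of the set. -/
lemma mem_convexHull_of_eq {V T : Finset E} {l : E →L[ℝ] ℝ} {c : ℝ} (hT : ∀ v ∈ T, l v = c)
    (hV : ∀ v ∈ V, v ∉ T → l v < c) {x : E}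
    (hx : x ∈ convexHull ℝ (V : Set E)) (hlx : l x = c) : x ∈ convexHull ℝ (T : Set E) := by
  classical
  obtain ⟨w, hw0, hw1, hwx⟩ := Finset.mem_convexHull'.1 hx
  have hle : ∀ v ∈ V, l v ≤ c := fun v hv => by
    by_cases h : v ∈ T
    · exact (hT v h).le
    · exact (hV v hv h).le
  -- The nonnegative deficits `c - l v` average to zero, so points off `T` carry no weight.
  have hsum : ∑ v ∈ V, w v * (c - l v) = 0 := by
    have h1 : l x = ∑ v ∈ V, w v * l v := by
      rw [← hwx, map_sum]; simp
    simp only [mul_sub, Finset.sum_sub_distrib, ← Finset.sum_mul, hw1, ← h1, hlx]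
    ring
  have hz := (Finset.sum_eq_zero_iff_of_nonneg
    (fun v hv => mul_nonneg (hw0 v hv) (sub_nonneg.2 (hle v hv)))).1 hsum
  have hw : ∀ v ∈ V, v ∉ T → w v = 0 := fun v hv hvT =>
    (mul_eq_zero.1 (hz v hv)).resolve_right (sub_pos.2 (hV v hv hvT)).ne'
  have hx' : x ∈ convexHull ℝ ((V.filter (· ∈ T) : Finset E) : Set E) := by
    refine Finset.mem_convexHull'.2 ⟨w, fun v hv => hw0 v (Finset.mem_filter.1 hv).1, ?_, ?_⟩
    · rw [Finset.sum_filter_of_ne, hw1]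
      exact fun v hv hne => by_contra fun h => hne (hw v hv h)
    · rw [Finset.sum_filter_of_ne, hwx]
      exact fun v hv hne => by_contra fun h => hne (by simp [hw v hv h])
  exact convexHull_mono (fun v hv => (Finset.mem_filter.1 (Finset.mem_coe.1 hv)).2) hx'

lemma IsExposedSubset.isExposed {V T : Finset E} (h : IsExposedSubset V T) :
    IsExposed ℝ (convexHull ℝ (V : Set E)) (convexHull ℝ (T : Set E)) := by
  obtain ⟨hTV, l, c, hT, hV⟩ := h
  intro hne
  obtain ⟨t, ht⟩ := convexHull_nonempty_iff.1 hne
  have hle : ∀ v ∈ V, l v ≤ c := fun v hv => by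
    by_cases h : v ∈ T
    · exact (hT v h).le
    · exact (hV v hv h).le
  refine ⟨l, Set.Subset.antisymm (fun x hx => ?_) fun x hx => ?_⟩
  · refine ⟨convexHull_mono (Finset.coe_subset.2 hTV) hx, fun y hy => ?_⟩
    rw [eq_of_mem_convexHull hT hx]
    exact le_of_mem_convexHull hle hy
  · refine mem_convexHull_of_eq hT hV hx.1 (le_antisymm (le_of_mem_convexHull hle hx.1) ?_)
    rw [← hT t ht]
    exact hx.2 t (subset_convexHull ℝ _ (hTV ht))

lemma isExposedSubset_filter_eq (V : Finset E) (l : E →L[ℝ] ℝ) {c : ℝ} (h : ∀ v ∈ V, l v ≤ c)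
    [DecidablePred fun v => l v = c] : IsExposedSubset V (V.filter fun v => l v = c) := by
  refine ⟨Finset.filter_subset _ _, l, c, fun v hv => (Finset.mem_filter.1 hv).2, fun v hv hvT => ?_⟩
  exact lt_of_le_of_ne (h v hv) fun hc => hvT (Finset.mem_filter.2 ⟨hv, hc⟩)

/-- With `IsExposedSubset.isExposed`, this moves between geometric faces and subsets of `V`. -/
lemma exists_isExposedSubset {V : Finset E} {F : Set E}
    (h : IsExposed ℝ (convexHull ℝ (V : Set E)) F) :
    ∃ T, IsExposedSubset V T ∧ F = convexHull ℝ (T : Set E) := by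
  classical
  rcases F.eq_empty_or_nonempty with rfl | hne
  -- The zero functional never attains the bound `1`, so the empty face is covered too.
  · exact ⟨∅, ⟨by simp, 0, 1, by simp, by simp⟩, by simp⟩
  obtain ⟨l, hl⟩ := h hne
  obtain ⟨x, hx⟩ := hne
  have hx' := hx
  rw [hl] at hx'
  have hle : ∀ v ∈ V, l v ≤ l x := fun v hv => hx'.2 v (subset_convexHull ℝ _ hv)
  refine ⟨V.filter fun v => l v = l x, isExposedSubset_filter_eq V l hle, ?_⟩
  have hT : ∀ v ∈ V.filter (fun v => l v = l x), l v = l x := fun v hv => (Finset.mem_filter.1 hv).2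
  refine Set.Subset.antisymm (fun y hy => ?_) fun y hy => ?_
  · have hy' := hy
    rw [hl] at hy'
    refine mem_convexHull_of_eq hT (fun v hv hvT => lt_of_le_of_ne (hle v hv) fun hc =>
      hvT (Finset.mem_filter.2 ⟨hv, hc⟩)) hy'.1 (le_antisymm (hx'.2 y hy'.1) (hy'.2 x hx'.1))
  · rw [hl]
    refine ⟨convexHull_mono (Finset.coe_subset.2 (Finset.filter_subset _ _)) hy, fun z hz => ?_⟩
    rw [eq_of_mem_convexHull hT hy]
    exact hx'.2 z hz

/-- A point of `V` in the convex hull of an exposed subset belongs to that subset. -/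
lemma IsExposedSubset.mem_of_mem_convexHull {V T : Finset E} (h : IsExposedSubset V T) {v : E}
    (hv : v ∈ V) (hvT : v ∈ convexHull ℝ (T : Set E)) : v ∈ T := by
  obtain ⟨-, l, c, hT, hV⟩ := h
  by_contra hn
  exact (hV v hv hn).ne (eq_of_mem_convexHull hT hvT)

lemma InConvexPosition.mem_of_mem_convexHull {V T : Finset E} (hV : InConvexPosition V)
    (hTV : T ⊆ V) {v : E} (hv : v ∈ V) (hvT : v ∈ convexHull ℝ (T : Set E)) : v ∈ T := by
  obtain ⟨-, l, c, hl, hlt⟩ := hV v hv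
  by_contra hn
  have hlc := hl v (Finset.mem_singleton_self v)
  have key : ∀ u ∈ T, l u < c := fun u hu => hlt u (hTV hu) fun h =>
    hn (Finset.mem_singleton.1 h ▸ hu)
  exact (convexHull_min (t := {y | l y < c}) (fun u hu => key u hu)
    (convex_halfSpace_lt l.toLinearMap.isLinear c) hvT : l v < c).ne hlc

/-- Exposed subsets of exposed subsets are exposed. -/
lemma IsExposedSubset.trans {V T U : Finset E} (hVT : IsExposedSubset V T)
    (hTU : IsExposedSubset T U) : IsExposedSubset V U := by
  classical
  obtain ⟨hTV, l, c, hT, hV⟩ := hVT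
  obtain ⟨hUT, k, d, hU, hT'⟩ := hTU
  -- A small multiple of `k` is added to `l`: it separates `U` within `T` without closing the
  -- finitely many positive gaps of `l` off `T`.
  obtain ⟨ε, hε, hεV⟩ : ∃ ε > 0, ∀ v ∈ V, v ∉ T → ε * (k v - d) < c - l v := by
    have : ∀ᶠ ε in nhdsWithin (0 : ℝ) (Set.Ioi 0), ∀ v ∈ V, v ∉ T → ε * (k v - d) < c - l v := by
      rw [Filter.eventually_all_finset]
      intro v hv
      by_cases hvT : v ∈ T
      · exact Filter.Eventually.of_forall fun ε h => absurd hvT h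
      · have h1 : Filter.Tendsto (fun ε : ℝ => ε * (k v - d)) (nhdsWithin 0 (Set.Ioi 0))
            (nhds (0 * (k v - d))) :=
          ((continuous_id.mul continuous_const).tendsto 0).mono_left nhdsWithin_le_nhds
        rw [zero_mul] at h1
        filter_upwards [h1.eventually_lt_const (sub_pos.2 (hV v hv hvT))] with ε hε _ using hε
    obtain ⟨ε, h1, h2⟩ := (this.and self_mem_nhdsWithin).exists
    exact ⟨ε, h2, h1⟩
  refine ⟨hUT.trans hTV, l + ε • k, c + ε * d, fun v hv => ?_, fun v hv hvU => ?_⟩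
  · simp [hT v (hUT hv), hU v hv]
  · by_cases hvT : v ∈ T
    · have := hT' v hvT hvU
      simp only [add_apply, smul_apply, smul_eq_mul,
        hT v hvT]
      nlinarith
    · have := hεV v hv hvT
      simp only [add_apply, smul_apply, smul_eq_mul]
      nlinarith

lemma IsExposedSubset.of_subset {V T U : Finset E} (hVU : IsExposedSubset V U) (hUT : U ⊆ T)
    (hTV : T ⊆ V) : IsExposedSubset T U := by
  obtain ⟨-, l, c, hU, hV⟩ := hVU
  exact ⟨hUT, l, c, hU, fun v hv => hV v (hTV hv)⟩

lemma InConvexPosition.subset {V T : Finset E} (hV : InConvexPosition V) (hTV : T ⊆ V) :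
    InConvexPosition T := fun v hv =>
  (hV v (hTV hv)).of_subset (Finset.singleton_subset_iff.2 hv) hTV

/-- A set none of whose points lies in the convex hull of the others is in convex position. -/
lemma inConvexPosition_of_notMem [DecidableEq E] {V : Finset E}
    (h : ∀ v ∈ V, v ∉ convexHull ℝ ((V.erase v : Finset E) : Set E)) : InConvexPosition V := by
  intro v hv
  obtain ⟨f, u, w, hfu, h1, h2⟩ := geometric_hahn_banach_compact_closed (E := E)
    (s := convexHull ℝ ((V.erase v : Finset E) : Set E)) (t := {v}) (convex_convexHull ℝ _)
    ((V.erase v).finite_toSet.isCompact_convexHull (𝕜 := ℝ)) (convex_singleton v) isClosed_singleton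
    (Set.disjoint_singleton_right.2 (h v hv))
  refine ⟨Finset.singleton_subset_iff.2 hv, f, f v, by simp, fun p hp hpv => ?_⟩
  refine (hfu p (subset_convexHull ℝ _ ?_)).trans (h1.trans (h2 v rfl))
  simpa using ⟨hp, fun h => hpv (by simp [h])⟩

/-- Every convex hull of finitely many points is spanned by a set in convex position. -/
lemma exists_inConvexPosition (S : Finset E) :
    ∃ V ⊆ S, convexHull ℝ (V : Set E) = convexHull ℝ (S : Set E) ∧ InConvexPosition V := by
  classical
  -- In an inclusion-minimal spanning subset no point lies in the hull of the others.
  obtain ⟨V, hV⟩ := Finset.exists_minimal (s := S.powerset.filter fun V : Finset E =>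
    convexHull ℝ (V : Set E) = convexHull ℝ (S : Set E)) ⟨S, by simp⟩
  have hmem := hV.1
  simp only [Finset.mem_filter, Finset.mem_powerset] at hmem
  refine ⟨V, hmem.1, hmem.2, inConvexPosition_of_notMem fun v hv hvc => ?_⟩
  have hins : convexHull ℝ ((V.erase v : Finset E) : Set E) = convexHull ℝ (V : Set E) := by
    refine Set.Subset.antisymm (convexHull_mono (by simp)) (convexHull_min (fun p hp => ?_)
      (convex_convexHull ℝ _))
    by_cases hpv : p = v
    · exact hpv ▸ hvc
    · exact subset_convexHull ℝ _ (by simpa using ⟨hp, hpv⟩)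
  have := hV.2 (y := V.erase v) (by
    simp only [Finset.mem_filter, Finset.mem_powerset]
    exact ⟨(Finset.erase_subset _ _).trans hmem.1, hins.trans hmem.2⟩) (Finset.erase_subset _ _)
  exact Finset.notMem_erase v V (this hv)

lemma convexHull_eq_singleton {T : Finset E} {v : E} (h : {v} = convexHull ℝ (T : Set E)) :
    T = {v} := by
  have hne : T.Nonempty := by
    by_contra hn
    rw [Finset.not_nonempty_iff_eq_empty] at hn
    simp [hn] at h
  refine (Finset.eq_singleton_iff_nonempty_unique_mem).2 ⟨hne, fun p hp => ?_⟩
  have : p ∈ ({v} : Set E) := h ▸ subset_convexHull ℝ _ hp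
  simpa using this

lemma isExposed_singleton_iff {V : Finset E} {v : E} :
    IsExposed ℝ (convexHull ℝ (V : Set E)) {v} ↔ IsExposedSubset V {v} := by
  refine ⟨fun h => ?_, fun h => by simpa using h.isExposed⟩
  obtain ⟨T, hT, hvT⟩ := exists_isExposedSubset h
  rwa [convexHull_eq_singleton hvT] at hT

lemma InConvexPosition.isExposed_segment_iff [DecidableEq E] {V : Finset E}
    (hV : InConvexPosition V) {u v : E} (hu : u ∈ V) (hv : v ∈ V) :
    IsExposed ℝ (convexHull ℝ (V : Set E)) (segment ℝ u v) ↔ IsExposedSubset V {u, v} := by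
  have hseg : segment ℝ u v = convexHull ℝ (({u, v} : Finset E) : Set E) := by
    simp [convexHull_pair]
  rw [hseg]
  refine ⟨fun h => ?_, fun h => h.isExposed⟩
  obtain ⟨T, hT, hvT⟩ := exists_isExposedSubset h
  have huv : ({u, v} : Finset E) ⊆ V := by
    intro p; simp only [Finset.mem_insert, Finset.mem_singleton]; rintro (rfl | rfl) <;> assumption
  have : T = {u, v} := by
    refine Finset.Subset.antisymm (fun p hp => ?_) fun p hp => ?_
    · exact hV.mem_of_mem_convexHull huv (hT.1 hp) (hvT ▸ subset_convexHull ℝ _ hp)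
    · exact hV.mem_of_mem_convexHull hT.1 (huv hp) (hvT ▸ subset_convexHull ℝ _ hp)
  rwa [← this]

/-- Three vertices are not collinear. -/
lemma InConvexPosition.smul_sub_ne {V : Finset E} (hV : InConvexPosition V) {v u w : E}
    (hv : v ∈ V) (hu : u ∈ V) (hw : w ∈ V) (huv : u ≠ v) (hwv : w ≠ v) (huw : u ≠ w)
    {a b : ℝ} (ha : 0 < a) (hb : 0 < b) : b • (u - v) ≠ a • (w - v) := by
  intro h
  obtain ⟨-, l, c, hl, hlt⟩ := hV u hu
  obtain ⟨-, k, d, hk, hkt⟩ := hV w hw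
  have h1 := hl u (by simp)
  have h2 := hlt v hv (by simpa using huv.symm)
  have h3 := hlt w hw (by simpa using huw.symm)
  have h4 := hk w (by simp)
  have h5 := hkt v hv (by simpa using hwv.symm)
  have h6 := hkt u hu (by simpa using huw)
  have e1 := congrArg l h
  have e2 := congrArg k h
  simp only [map_smul, map_sub, smul_eq_mul] at e1 e2
  -- If `u` and `w` lay on one ray from `v`, the functional exposing `u` would force `b < a` and the
  -- one exposing `w` the reverse.
  have hab : b < a := by
    by_contra hcon
    push Not at hcon
    nlinarith
  nlinarith

end ExposedSubset

/-! ### Monotone edge paths and linking across a hyperplane. -/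

section Paths

variable {E : Type*} [NormedAddCommGroup E] [NormedSpace ℝ E] [DecidableEq E]

/-- If `h` exposes `v` with value `c`, the directions from `v` that maximise the ratio of `k` to the
descent of `h` span an exposed subset. -/
lemma exists_isExposedSubset_ratio {T : Finset E} {v : E} (hv : v ∈ T) (hT : T ≠ {v})
    {h : E →L[ℝ] ℝ} {c : ℝ} (hvc : h v = c) (hc : ∀ p ∈ T, p ≠ v → h p < c) (k : E →L[ℝ] ℝ) :
    ∃ (r : ℝ) (U : Finset E), v ∈ U ∧ U ≠ {v} ∧ IsExposedSubset T U ∧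
      ∀ p ∈ T, p ≠ v → k (p - v) ≤ r * (c - h p) ∧ (p ∈ U ↔ k (p - v) = r * (c - h p)) := by
  have hne : (T.erase v).Nonempty := by
    rw [Finset.nonempty_iff_ne_empty]
    intro he
    rcases (Finset.erase_eq_empty_iff T v).1 he with h | h
    · simp [h] at hv
    · exact hT h
  obtain ⟨m, hm, hmax⟩ := Finset.exists_max_image (T.erase v)
    (fun p => k (p - v) / (c - h p)) hne
  set r := k (m - v) / (c - h m) with hr
  have hle : ∀ p ∈ T, k (p - v) ≤ r * (c - h p) := fun p hp => by
    by_cases hpv : p = v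
    · simp [hpv, hvc]
    · exact (div_le_iff₀ (sub_pos.2 (hc p hp hpv))).1
        (hmax p (Finset.mem_erase.2 ⟨hpv, hp⟩))
  -- Since `r` is the largest ratio, `k + r • h` is bounded on `T` by its value at `v`, with
  -- equality exactly where the ratio is attained.
  refine ⟨r, T.filter fun p => k (p - v) = r * (c - h p), ?_, fun he => ?_, ⟨Finset.filter_subset _ _,
    k + r • h, k v + r * c, fun p hp => ?_, fun p hp hpU => ?_⟩, fun p hp hpv => ⟨hle p hp, ?_⟩⟩
  · simp [hv, hvc]
  · have hmU : m ∈ T.filter fun p => k (p - v) = r * (c - h p) := by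
      rw [Finset.mem_erase] at hm
      refine Finset.mem_filter.2 ⟨hm.2, ?_⟩
      rw [hr, div_mul_cancel₀ _ (sub_pos.2 (hc m hm.2 hm.1)).ne']
    rw [he, Finset.mem_singleton] at hmU
    exact (Finset.mem_erase.1 hm).1 hmU
  · have := (Finset.mem_filter.1 hp).2
    rw [map_sub] at this
    simp only [add_apply, smul_apply, smul_eq_mul]
    linarith
  · have h1 := hle p hp
    have h2 : k (p - v) ≠ r * (c - h p) := fun he => hpU (Finset.mem_filter.2 ⟨hp, he⟩)
    have h3 := lt_of_le_of_ne h1 h2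
    rw [map_sub] at h3
    simp only [add_apply, smul_apply, smul_eq_mul]
    linarith
  · simp [hp]

/-- A vertex that does not maximise `f` is the end of an edge along which `f` increases. -/
theorem InConvexPosition.exists_edge {V : Finset E} (hV : InConvexPosition V) (f : E →L[ℝ] ℝ)
    {v w : E} (hv : v ∈ V) (hw : w ∈ V) (hvw : f v < f w) :
    ∃ u ∈ V, f v < f u ∧ IsExposedSubset V {v, u} := by
  obtain ⟨-, h, c, hvc, hc⟩ := hV v hv
  replace hvc := hvc v (by simp)
  replace hc : ∀ p ∈ V, p ≠ v → h p < c := fun p hp hpv => hc p hp (by simpa using hpv)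
  have hwv : w ≠ v := fun h => by simp [h] at hvw
  have hVv : V ≠ {v} := fun h => hwv (by simpa [h] using hw)
  classical
  -- A smallest face through `v`, other than `{v}`, on which `f` exceeds `f v` away from `v`. One
  -- such face comes from the ratio lemma for `f`: the ratio at `w` is positive, hence so is the
  -- maximum `r`.
  obtain ⟨T, hT⟩ := Finset.exists_minimal (s := V.powerset.filter fun T : Finset E =>
      IsExposedSubset V T ∧ v ∈ T ∧ T ≠ {v} ∧ ∀ p ∈ T, p ≠ v → f v < f p) (by
    obtain ⟨r, U, hvU, hUv, hU, hr⟩ := exists_isExposedSubset_ratio hv hVv hvc hc f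
    have hr0 : 0 < r := by
      have h1 := (hr w hw hwv).1
      have h2 := hc w hw hwv
      rw [map_sub] at h1
      by_contra hcon
      nlinarith
    refine ⟨U, Finset.mem_filter.2 ⟨Finset.mem_powerset.2 hU.1, hU, hvU, hUv, fun p hp hpv => ?_⟩⟩
    have h1 := (hr p (hU.1 hp) hpv).2.1 hp
    have h2 := mul_pos hr0 (sub_pos.2 (hc p (hU.1 hp) hpv))
    rw [map_sub] at h1
    linarith)
  obtain ⟨-, hTV, hvT, hTv, hTf⟩ := Finset.mem_filter.1 hT.1
  obtain ⟨u, huT, huv⟩ : ∃ u ∈ T, u ≠ v := by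
    by_contra! hcon
    exact hTv ((Finset.eq_singleton_iff_unique_mem).2 ⟨hvT, hcon⟩)
  suffices hsub : T = {v, u} from ⟨u, hTV.1 huT, hTf u huT huv, hsub ▸ hTV⟩
  by_contra hcon
  obtain ⟨w, hwT, hwv, hwu⟩ : ∃ w ∈ T, w ≠ v ∧ w ≠ u := by
    by_contra! hcon'
    refine hcon (Finset.Subset.antisymm (fun p hp => ?_) fun p hp => ?_)
    · by_cases hpv : p = v
      · simp [hpv]
      · simp [hcon' p hp hpv]
    · rcases Finset.mem_insert.1 hp with rfl | hp
      · exact hvT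
      · rwa [Finset.mem_singleton.1 hp]
  have hcu := sub_pos.2 (hc u (hTV.1 huT) huv)
  have hcw := sub_pos.2 (hc w (hTV.1 hwT) hwv)
  -- Rescaled to equal descent of `h`, the directions to `u` and `w` differ. A functional `k` that
  -- tells them apart has different ratios at `u` and `w`, so its ratio face cannot contain both,
  -- against minimality.
  obtain ⟨k, hk⟩ := SeparatingDual.exists_separating_of_ne (R := ℝ)
    (hV.smul_sub_ne hv (hTV.1 huT) (hTV.1 hwT) huv hwv hwu.symm hcu hcw)
  obtain ⟨r, U, hvU, hUv, hU, hr⟩ := exists_isExposedSubset_ratio hvT hTv hvc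
    (fun p hp => hc p (hTV.1 hp)) k
  have hUT := hT.2 (y := U) (Finset.mem_filter.2 ⟨Finset.mem_powerset.2 (hU.1.trans hTV.1),
    hTV.trans hU, hvU, hUv, fun p hp => hTf p (hU.1 hp)⟩) hU.1
  refine hk ?_
  have h1 := (hr u huT huv).2.1 (hUT huT)
  have h2 := (hr w hwT hwv).2.1 (hUT hwT)
  rw [map_smul, map_smul, h1, h2, smul_eq_mul, smul_eq_mul]
  ring

/-- `u` and `w` are joined by a path of edges of `V` that visits only points of `S`. -/
def JoinedWithin (V : Finset E) (S : Set E) : E → E → Prop :=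
  Relation.ReflTransGen fun a b => a ∈ S ∧ b ∈ S ∧ a ≠ b ∧ IsExposedSubset V {a, b}

lemma JoinedWithin.head {V : Finset E} {S : Set E} {u v w : E} (hu : u ∈ S) (hv : v ∈ S)
    (huv : u ≠ v) (he : IsExposedSubset V {u, v}) (h : JoinedWithin V S v w) :
    JoinedWithin V S u w :=
  Relation.ReflTransGen.head ⟨hu, hv, huv, he⟩ h

lemma JoinedWithin.symm {V : Finset E} {S : Set E} {u w : E} (h : JoinedWithin V S u w) :
    JoinedWithin V S w u := by
  have : Std.Symm fun a b => a ∈ S ∧ b ∈ S ∧ a ≠ b ∧ IsExposedSubset V {a, b} :=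
    ⟨fun a b ⟨h1, h2, h3, h4⟩ => ⟨h2, h1, h3.symm, by rwa [Finset.pair_comm]⟩⟩
  exact Relation.ReflTransGen.stdSymm.symm _ _ h

lemma JoinedWithin.mono {V T : Finset E} (hT : IsExposedSubset V T) {S S' : Set E} (hS : S ⊆ S')
    {u w : E} (h : JoinedWithin T S u w) : JoinedWithin V S' u w :=
  Relation.ReflTransGen.mono (fun _ _ ⟨h1, h2, h3, h4⟩ => ⟨hS h1, hS h2, h3, hT.trans h4⟩) _ _ h

/-- From every vertex an increasing path leads to a maximum of `f`. -/
lemma InConvexPosition.exists_joinedWithin_max {V : Finset E} (hV : InConvexPosition V)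
    (f : E →L[ℝ] ℝ) {u : E} (hu : u ∈ V) :
    ∃ w ∈ V, (∀ p ∈ V, f p ≤ f w) ∧ JoinedWithin V {p | p ∈ V ∧ f u ≤ f p} u w := by
  induction hn : (V.filter fun p => f u < f p).card using Nat.strong_induction_on generalizing u with
  | _ n ih =>
    by_cases hmax : ∀ p ∈ V, f p ≤ f u
    · exact ⟨u, hu, hmax, Relation.ReflTransGen.refl⟩
    · push Not at hmax
      obtain ⟨p, hp, hup⟩ := hmax
      obtain ⟨q, hq, huq, hedge⟩ := hV.exists_edge f hu hp hup
      obtain ⟨w, hw, hwmax, hj⟩ := ih _ (by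
        rw [← hn]
        refine Finset.card_lt_card (Finset.ssubset_iff_of_subset (fun y hy => ?_) |>.2
          ⟨q, by simp [hq, huq], by simp⟩)
        rw [Finset.mem_filter] at hy ⊢
        exact ⟨hy.1, huq.trans hy.2⟩) hq rfl
      refine ⟨w, hw, hwmax, ?_⟩
      refine JoinedWithin.head (v := q) ⟨hu, le_rfl⟩ ⟨hq, huq.le⟩ ?_ hedge
        (JoinedWithin.mono (.refl V) (Set.ofPred_subset_ofPred.2 fun y hy => And.imp id huq.le.trans hy) hj)
      rintro rfl
      exact lt_irrefl _ huq

/-- An increasing path may end at a maximum other than `m`. A second path, inside the face where `f`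
is maximal and increasing for a functional that exposes `m`, then leads to `m`. -/
lemma InConvexPosition.joinedWithin_of_max {V : Finset E} (hV : InConvexPosition V)
    (f : E →L[ℝ] ℝ) {u m : E} (hu : u ∈ V) (hm : m ∈ V) (hmax : ∀ p ∈ V, f p ≤ f m) :
    JoinedWithin V {p | p ∈ V ∧ f u ≤ f p} u m := by
  obtain ⟨w, hw, hwmax, hj⟩ := hV.exists_joinedWithin_max f hu
  have hwm : f w = f m := le_antisymm (hmax w hw) (hwmax m hm)
  have hT := isExposedSubset_filter_eq V f (c := f m) hmax
  obtain ⟨-, h, c, hmc, hc⟩ := hV m hm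
  replace hmc := hmc m (by simp)
  obtain ⟨w', hw', hw'max, hj'⟩ := (hV.subset hT.1).exists_joinedWithin_max h
    (u := w) (Finset.mem_filter.2 ⟨hw, hwm⟩)
  have hw'm : w' = m := by
    by_contra hne
    have h1 := hc w' (hT.1 hw') (by simpa using hne)
    have h2 := hw'max m (Finset.mem_filter.2 ⟨hm, rfl⟩)
    linarith
  subst hw'm
  refine Relation.ReflTransGen.trans hj (hj'.mono hT fun p hp => ?_)
  have := Finset.mem_filter.1 hp.1
  exact ⟨this.1, this.2 ▸ hmax u hu⟩

/-- Two vertices in a closed half-space are joined through the open half-space. -/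
theorem InConvexPosition.joinedWithin_halfSpace {V : Finset E} (hV : InConvexPosition V)
    (f : E →L[ℝ] ℝ) (a : ℝ) {s t q : E} (hs : s ∈ V) (ht : t ∈ V) (hq : q ∈ V) (hsa : a ≤ f s)
    (hta : a ≤ f t) (hqa : a < f q) :
    JoinedWithin V ({s, t} ∪ {p | p ∈ V ∧ a < f p}) s t := by
  obtain ⟨m, hm, hmax⟩ := V.exists_max_image f ⟨q, hq⟩
  have key : ∀ u ∈ V, a ≤ f u → u ∈ ({s, t} : Set E) →
      JoinedWithin V ({s, t} ∪ {p | p ∈ V ∧ a < f p}) u m := by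
    intro u hu hua hust
    rcases hua.lt_or_eq with hlt | heq
    · exact (hV.joinedWithin_of_max f hu hm hmax).mono (.refl V)
        fun p hp => Or.inr ⟨hp.1, hlt.trans_le hp.2⟩
    -- A start on the hyperplane is not a maximum because of `q`, so one edge leaves the hyperplane
    -- at once.
    · obtain ⟨w, hw, hlt, hedge⟩ := hV.exists_edge f hu hq (heq ▸ hqa)
      refine JoinedWithin.head (Or.inl hust) (Or.inr ⟨hw, hua.trans_lt hlt⟩) ?_ hedge ?_
      · rintro rfl
        exact lt_irrefl _ hlt
      · exact (hV.joinedWithin_of_max f hw hm hmax).mono (.refl V)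
          fun p hp => Or.inr ⟨hp.1, (hua.trans_lt hlt).trans_le hp.2⟩
  exact Relation.ReflTransGen.trans (key s hs hsa (by simp)) (key t ht hta (by simp)).symm

/-- There are disjoint paths from `s` to `t` and from `s'` to `t'` that avoid `x`. -/
def LinkedAvoiding (V : Finset E) (x s t s' t' : E) : Prop :=
  ∃ S S' : Set E, Disjoint S S' ∧ x ∉ S ∧ x ∉ S' ∧ s ∈ S ∧ s' ∈ S' ∧
    JoinedWithin V S s t ∧ JoinedWithin V S' s' t'

lemma LinkedAvoiding.swap {V : Finset E} {x s t s' t' : E} (h : LinkedAvoiding V x s t s' t') :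
    LinkedAvoiding V x s' t' s t := by
  obtain ⟨S, S', h1, h2, h3, h4, h5, h6, h7⟩ := h
  exact ⟨S', S, h1.symm, h3, h2, h5, h4, h7, h6⟩

/-- One path runs strictly below the hyperplane and the other strictly above, except perhaps at
their ends; `x` lies on the hyperplane and is none of the ends. -/
lemma InConvexPosition.linkedAvoiding_of_halfSpace {V : Finset E} (hV : InConvexPosition V)
    (f : E →L[ℝ] ℝ) {x s t s' t' p q : E} (hs : s ∈ V) (ht : t ∈ V)
    (hs' : s' ∈ V) (ht' : t' ∈ V) (hp : p ∈ V) (hq : q ∈ V)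
    (hnd : [x, s, t, s', t'].Nodup) (hsx : f s = f x) (htx : f t = f x) (hs'x : f x ≤ f s')
    (ht'x : f x ≤ f t') (hpx : f p < f x) (hqx : f x < f q) : LinkedAvoiding V x s t s' t' := by
  simp only [List.nodup_cons, List.mem_cons, List.not_mem_nil, not_or, or_false] at hnd
  obtain ⟨⟨hxs, hxt, hxs', hxt'⟩, ⟨-, hss', hst'⟩, ⟨hts', htt'⟩, -⟩ := hnd
  have h1 := hV.joinedWithin_halfSpace (-f) (-f x) hs ht hp (by simp [hsx]) (by simp [htx])
    (by simpa using hpx)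
  have h2 := hV.joinedWithin_halfSpace f (f x) hs' ht' hq hs'x ht'x hqx
  refine ⟨_, _, ?_, ?_, ?_, ?_, ?_, h1, h2⟩
  · rw [Set.disjoint_left]
    rintro y ((rfl | rfl) | ⟨-, hy⟩) ((rfl | rfl) | ⟨-, hy'⟩) <;>
      first
      | contradiction
      | (simp at *; linarith)
  · simp [hxs, hxt]
  · simp [hxs', hxt']
  · simp
  · simp

end Paths

/-! ### Vertices and edges of the standard cube. -/

section Cube

/-- The vertex of the standard cube with the given zero-one coordinates. -/
noncomputable def cubeVertex {d : ℕ} (σ : Fin d → Bool) : EuclideanSpace ℝ (Fin d) :=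
  WithLp.toLp 2 fun j => if σ j then 1 else 0

lemma cubeVertex_apply {d : ℕ} (σ : Fin d → Bool) (j : Fin d) :
    cubeVertex σ j = if σ j then 1 else 0 := rfl

lemma cubeVertex_injective {d : ℕ} : Function.Injective (cubeVertex (d := d)) := by
  intro σ τ h
  funext j
  have := congrArg (fun x : EuclideanSpace ℝ (Fin d) => x j) h
  simp only [cubeVertex_apply] at this
  cases h1 : σ j <;> cases h2 : τ j <;> simp_all

open Classical in
/-- The vertices of the standard cube. -/
noncomputable def cubeVertices (d : ℕ) : Finset (EuclideanSpace ℝ (Fin d)) :=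
  Finset.univ.image cubeVertex

lemma mem_cubeVertices {d : ℕ} {x : EuclideanSpace ℝ (Fin d)} :
    x ∈ cubeVertices d ↔ ∃ σ, cubeVertex σ = x := by
  simp [cubeVertices]

lemma convexHull_cubeVertices (d : ℕ) :
    convexHull ℝ (cubeVertices d : Set (EuclideanSpace ℝ (Fin d))) = stdCube d := by
  have h1 : (cubeVertices d : Set (EuclideanSpace ℝ (Fin d))) =
      (WithLp.linearEquiv 2 ℝ (Fin d → ℝ)).symm '' Set.univ.pi fun _ => ({0, 1} : Set ℝ) := by
    ext x
    simp only [Finset.mem_coe, mem_cubeVertices, Set.mem_image, Set.mem_pi, Set.mem_univ,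
      true_implies, Set.mem_insert_iff, Set.mem_singleton_iff]
    constructor
    · rintro ⟨σ, rfl⟩
      exact ⟨fun j => if σ j then 1 else 0, fun j => by cases σ j <;> simp, rfl⟩
    · rintro ⟨y, hy, rfl⟩
      refine ⟨fun j => decide (y j = 1), ?_⟩
      ext j
      rcases hy j with h | h <;> simp [cubeVertex, h]
  rw [h1, ← LinearEquiv.coe_toLinearMap, ← LinearMap.image_convexHull, convexHull_pi]
  simp only [convexHull_pair, segment_eq_Icc zero_le_one]
  ext x
  simp only [stdCube, Set.mem_image, Set.mem_pi, Set.mem_univ, true_implies, Set.mem_Icc]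
  constructor
  · rintro ⟨y, hy, rfl⟩
    exact hy
  · intro hx
    exact ⟨WithLp.ofLp x, hx, rfl⟩

/-- The vertices of the cube that agree with `σ` outside a set of coordinates span a face. -/
lemma isExposedSubset_cubeVertices {d : ℕ} (σ : Fin d → Bool) (J : Finset (Fin d))
    {U : Finset (EuclideanSpace ℝ (Fin d))} (hU : U ⊆ cubeVertices d)
    (h : ∀ τ, cubeVertex τ ∈ U ↔ ∀ j ∉ J, τ j = σ j) : IsExposedSubset (cubeVertices d) U := by
  -- The signs reward agreement with `σ` in each coordinate outside `J`, so the bound is met exactly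
  -- when all of these agree.
  refine ⟨hU, ∑ j ∈ Jᶜ, (if σ j then (1 : ℝ) else -1) • EuclideanSpace.proj j,
    ∑ j ∈ Jᶜ, if σ j then (1 : ℝ) else 0, fun v hv => ?_, fun v hv hvU => ?_⟩
  · obtain ⟨τ, rfl⟩ := mem_cubeVertices.1 (hU hv)
    rw [sum_apply]
    refine Finset.sum_congr rfl fun j hj => ?_
    have := (h τ).1 hv j (Finset.mem_compl.1 hj)
    cases h1 : σ j <;> simp [cubeVertex_apply, this, h1]
  · obtain ⟨τ, rfl⟩ := mem_cubeVertices.1 hv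
    rw [h] at hvU
    push Not at hvU
    obtain ⟨j, hj, hne⟩ := hvU
    rw [sum_apply]
    refine Finset.sum_lt_sum (fun i _ => ?_) ⟨j, Finset.mem_compl.2 hj, ?_⟩
    · cases h1 : σ i <;> cases h2 : τ i <;> simp [cubeVertex_apply, h2]
    · cases h1 : σ j <;> cases h2 : τ j <;> simp_all [cubeVertex_apply]

lemma inConvexPosition_cubeVertices (d : ℕ) : InConvexPosition (cubeVertices d) := by
  intro v hv
  obtain ⟨σ, rfl⟩ := mem_cubeVertices.1 hv
  refine isExposedSubset_cubeVertices σ ∅ (Finset.singleton_subset_iff.2 hv) fun τ => ?_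
  rw [Finset.mem_singleton, cubeVertex_injective.eq_iff]
  simp [funext_iff]

lemma isExposedSubset_cubeVertices_pair {d : ℕ} [DecidableEq (EuclideanSpace ℝ (Fin d))]
    (σ : Fin d → Bool) (j : Fin d) : IsExposedSubset (cubeVertices d)
      {cubeVertex σ, cubeVertex (Function.update σ j (!σ j))} := by
  refine isExposedSubset_cubeVertices σ {j} (fun v hv => ?_) fun τ => ?_
  · rw [Finset.mem_insert, Finset.mem_singleton] at hv
    rcases hv with rfl | rfl <;> exact mem_cubeVertices.2 ⟨_, rfl⟩
  · rw [Finset.mem_insert, Finset.mem_singleton, cubeVertex_injective.eq_iff,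
      cubeVertex_injective.eq_iff]
    constructor
    · rintro (rfl | rfl) i hi
      · rfl
      · exact Function.update_of_ne (by simpa using hi) _ _
    · intro hτ
      by_cases hj : τ j = σ j
      · left
        funext i
        by_cases hi : i = j
        · rw [hi, hj]
        · exact hτ i (by simpa using hi)
      · right
        funext i
        by_cases hi : i = j
        · subst hi
          rw [Function.update_self]
          revert hj
          cases τ i <;> cases σ i <;> simp
        · rw [Function.update_of_ne hi]
          exact hτ i (by simpa using hi)

end Cube

/-! ### Transport of vertices and edges along face lattice isomorphisms. -/

section FaceLattice

instance {n : ℕ} (P : Set (EuclideanSpace ℝ (Fin n))) : OrderBot (Face P) where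
  bot := ⟨∅, fun h => absurd h Set.not_nonempty_empty⟩
  bot_le F := Set.empty_subset F.1

lemma face_bot_coe {n : ℕ} (P : Set (EuclideanSpace ℝ (Fin n))) : ((⊥ : Face P).1 : Set (EuclideanSpace ℝ (Fin n))) = ∅ := rfl

/-- Every nonempty face contains a point of `V`, which is itself a face. This describes vertices in
terms of the order alone. -/
lemma InConvexPosition.isAtom_iff {n : ℕ} {V : Finset (EuclideanSpace ℝ (Fin n))}
    (hV : InConvexPosition V) (F : Face (convexHull ℝ (V : Set (EuclideanSpace ℝ (Fin n))))) :
    IsAtom F ↔ ∃ v ∈ V, F.1 = {v} := by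
  constructor
  · intro hF
    obtain ⟨T, hT, hFT⟩ := exists_isExposedSubset F.2
    have hne : T.Nonempty := by
      rw [Finset.nonempty_iff_ne_empty]
      rintro rfl
      exact hF.1 (Subtype.ext (by simpa [face_bot_coe] using hFT))
    obtain ⟨t, ht⟩ := hne
    refine ⟨t, hT.1 ht, ?_⟩
    let G : Face (convexHull ℝ (V : Set (EuclideanSpace ℝ (Fin n)))) :=
      ⟨{t}, isExposed_singleton_iff.2 (hV t (hT.1 ht))⟩
    have hG : G ≠ ⊥ := fun h => Set.singleton_ne_empty t (congrArg Subtype.val h)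
    have hle : G ≤ F := by
      change ({t} : Set _) ⊆ F.1
      rw [hFT, Set.singleton_subset_iff]
      exact subset_convexHull ℝ _ ht
    exact (congrArg Subtype.val ((hF.le_iff.1 hle).resolve_left hG)).symm
  · rintro ⟨v, -, hF⟩
    refine ⟨fun h => ?_, fun G hG => ?_⟩
    · rw [h, face_bot_coe] at hF
      exact Set.singleton_ne_empty v hF.symm
    · have h1 : G.1 ⊆ {v} := hF ▸ hG.le
      rcases Set.subset_singleton_iff_eq.1 h1 with h | h
      · exact Subtype.ext h
      · exact absurd (Subtype.ext (h.trans hF.symm)) hG.ne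

/-- An isomorphism of face lattices maps vertices to vertices and edges to edges. -/
lemma exists_vertex_map {m n : ℕ} {V : Finset (EuclideanSpace ℝ (Fin m))}
    {W : Finset (EuclideanSpace ℝ (Fin n))} [DecidableEq (EuclideanSpace ℝ (Fin m))]
    [DecidableEq (EuclideanSpace ℝ (Fin n))] (hV : InConvexPosition V) (hW : InConvexPosition W)
    (e : Face (convexHull ℝ (V : Set (EuclideanSpace ℝ (Fin m)))) ≃o
      Face (convexHull ℝ (W : Set (EuclideanSpace ℝ (Fin n))))) :
    ∃ φ : W → V, Function.Bijective φ ∧ ∀ a b : W, IsExposedSubset W {a.1, b.1} →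
      IsExposedSubset V {(φ a).1, (φ b).1} := by
  let aV : V → Face (convexHull ℝ (V : Set (EuclideanSpace ℝ (Fin m)))) := fun v =>
    ⟨{v.1}, isExposed_singleton_iff.2 (hV v v.2)⟩
  let aW : W → Face (convexHull ℝ (W : Set (EuclideanSpace ℝ (Fin n)))) := fun w =>
    ⟨{w.1}, isExposed_singleton_iff.2 (hW w w.2)⟩
  have haW : Function.Injective aW := fun a b h =>
    Subtype.ext (Set.singleton_injective (congrArg Subtype.val h))
  have haV : Function.Injective aV := fun a b h =>
    Subtype.ext (Set.singleton_injective (congrArg Subtype.val h))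
  have h1 : ∀ w : W, ∃ v : V, e.symm (aW w) = aV v := fun w => by
    obtain ⟨v, hv, h⟩ := (hV.isAtom_iff _).1
      ((e.symm.isAtom_iff _).2 ((hW.isAtom_iff (aW w)).2 ⟨w, w.2, rfl⟩))
    exact ⟨⟨v, hv⟩, Subtype.ext h⟩
  have h2 : ∀ v : V, ∃ w : W, e (aV v) = aW w := fun v => by
    obtain ⟨w, hw, h⟩ := (hW.isAtom_iff _).1
      ((e.isAtom_iff _).2 ((hV.isAtom_iff (aV v)).2 ⟨v, v.2, rfl⟩))
    exact ⟨⟨w, hw⟩, Subtype.ext h⟩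
  choose φ hφ using h1
  have hφ' : ∀ w, e (aV (φ w)) = aW w := fun w => by rw [← hφ, OrderIso.apply_symm_apply]
  have hsurj : Function.Surjective φ := fun v => by
    obtain ⟨w, hw⟩ := h2 v
    exact ⟨w, haV (e.injective ((hφ' w).trans hw.symm))⟩
  refine ⟨φ, ⟨fun a b hab => haW (by rw [← hφ', ← hφ', hab]), hsurj⟩, fun a b hab => ?_⟩
  let F : Face (convexHull ℝ (W : Set (EuclideanSpace ℝ (Fin n)))) := ⟨_, hab.isExposed⟩
  obtain ⟨T, hT, hFT⟩ := exists_isExposedSubset (e.symm F).2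
  -- Incidence of a vertex with a face is the order relation between an atom and the face, which the
  -- isomorphism preserves.
  have key : ∀ w : W, (φ w).1 ∈ T ↔ w = a ∨ w = b := fun w => by
    have h3 : (φ w).1 ∈ T ↔ aV (φ w) ≤ e.symm F := by
      change _ ↔ {(φ w).1} ⊆ (e.symm F).1
      rw [hFT, Set.singleton_subset_iff]
      exact ⟨fun h => subset_convexHull ℝ _ h, hT.mem_of_mem_convexHull (φ w).2⟩
    have h4 : aV (φ w) ≤ e.symm F ↔ aW w ≤ F := by rw [← hφ, e.symm.le_iff_le]
    have h5 : aW w ≤ F ↔ w.1 ∈ ({a.1, b.1} : Finset _) := by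
      change {w.1} ⊆ convexHull ℝ _ ↔ _
      rw [Set.singleton_subset_iff]
      exact ⟨hab.mem_of_mem_convexHull w.2, fun h => subset_convexHull ℝ _ h⟩
    rw [h3, h4, h5, Finset.mem_insert, Finset.mem_singleton, Subtype.ext_iff, Subtype.ext_iff]
  suffices T = {(φ a).1, (φ b).1} from this ▸ hT
  ext v
  rw [Finset.mem_insert, Finset.mem_singleton]
  constructor
  · intro hv
    obtain ⟨w, hw⟩ := hsurj ⟨v, hT.1 hv⟩
    have hwv : (φ w).1 = v := congrArg Subtype.val hw
    rcases (key w).1 (hwv ▸ hv) with rfl | rfl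
    · exact Or.inl hwv.symm
    · exact Or.inr hwv.symm
  · rintro (rfl | rfl)
    · exact (key a).2 (Or.inl rfl)
    · exact (key b).2 (Or.inr rfl)

end FaceLattice

/-! ### The graph of the 3-cube, with finite reachability checks. -/

section ThreeCube

/-- The coordinates of a vertex of the `3`-cube, numbered in binary. -/
def bits (i : Fin 8) : Fin 3 → Bool := fun j => i.1.testBit j

lemma bits_bijective : Function.Bijective bits := by
  rw [Fintype.bijective_iff_injective_and_card]
  exact ⟨by decide +kernel, by simp⟩

lemma bits_xor : ∀ (i : Fin 8) (j : Fin 3),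
    bits (i ^^^ ⟨2 ^ j.1, by fin_cases j <;> simp⟩) = Function.update (bits i) j (!bits i j) := by
  decide +kernel

/-- The vertices of a polytope equivalent to the `3`-cube can be numbered in binary so that any
given vertex gets number `0`. -/
lemma exists_cube_numbering {n : ℕ} {T : Finset (EuclideanSpace ℝ (Fin n))}
    [DecidableEq (EuclideanSpace ℝ (Fin n))] (hT : InConvexPosition T)
    (h : CombEquiv (convexHull ℝ (T : Set (EuclideanSpace ℝ (Fin n)))) (stdCube 3))
    {x : EuclideanSpace ℝ (Fin n)} (hx : x ∈ T) :
    ∃ ψ : Fin 8 → T, Function.Bijective ψ ∧ ψ 0 = ⟨x, hx⟩ ∧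
      ∀ i, ∀ d ∈ ([1, 2, 4] : List (Fin 8)), IsExposedSubset T {(ψ i).1, (ψ (i ^^^ d)).1} := by
  classical
  rw [← convexHull_cubeVertices] at h
  obtain ⟨e⟩ := h
  obtain ⟨φ, hφ, hedge⟩ := exists_vertex_map hT (inConvexPosition_cubeVertices 3) e
  let c : Fin 8 → cubeVertices 3 := fun i => ⟨cubeVertex (bits i), mem_cubeVertices.2 ⟨_, rfl⟩⟩
  have hc : Function.Bijective c := by
    refine ⟨fun a b hab => bits_bijective.1 (cubeVertex_injective (congrArg Subtype.val hab)), ?_⟩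
    rintro ⟨y, hy⟩
    obtain ⟨σ, rfl⟩ := mem_cubeVertices.1 hy
    obtain ⟨i, rfl⟩ := bits_bijective.2 σ
    exact ⟨i, rfl⟩
  obtain ⟨i₀, hi₀⟩ := (hφ.comp hc).2 ⟨x, hx⟩
  -- Translation by `i₀` is an automorphism of the cube graph and moves the number of `x` to `0`.
  have hxor : Function.Bijective fun i : Fin 8 => i ^^^ i₀ := by
    have : ∀ a b : Fin 8, b ^^^ a ^^^ a = b := by decide
    exact Function.Involutive.bijective (this i₀)
  refine ⟨fun i => φ (c (i ^^^ i₀)), hφ.comp (hc.comp hxor), ?_, fun i d hd => ?_⟩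
  · have : ∀ a : Fin 8, 0 ^^^ a = a := by decide
    simp only [this]
    exact hi₀
  · obtain ⟨j, hj⟩ : ∃ j : Fin 3, d = ⟨2 ^ j.1, by fin_cases j <;> simp⟩ := by
      revert d; decide
    have hcomm : i ^^^ d ^^^ i₀ = i ^^^ i₀ ^^^ d := by
      have : ∀ a b c : Fin 8, a ^^^ b ^^^ c = a ^^^ c ^^^ b := by decide +kernel
      exact this i d i₀
    apply hedge
    change IsExposedSubset _ {cubeVertex _, cubeVertex _}
    rw [hcomm, hj, bits_xor]
    exact isExposedSubset_cubeVertices_pair _ _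

/-- Reachability in the graph of the `3`-cube by at most `n` steps that avoid `Z`. -/
def cubeReach (Z : Fin 8 → Bool) : ℕ → Fin 8 → Fin 8 → Bool
  | 0, s, t => s == t
  | n + 1, s, t => s == t || [1, 2, 4].any fun d => !Z (s ^^^ d) && cubeReach Z n (s ^^^ d) t

lemma cubeReach_or : ∀ s t s' t' : Fin 8, [0, s, t, s', t'].Nodup →
    cubeReach (fun z => z == 0 || z == s' || z == t') 4 s t = true ∨
      cubeReach (fun z => z == 0 || z == s || z == t) 4 s' t' = true := by
  decide +kernel

lemma cubeReach_of_nodup : ∀ s t y : Fin 8, [0, s, t, y].Nodup →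
    cubeReach (fun z => z == 0 || z == y) 4 s t = true := by
  decide +kernel

/-- `cubeReach` tests `Z` only at the vertices it steps to, whence the separate hypothesis on the
start. -/
lemma joinedWithin_of_cubeReach {n : ℕ} {T : Finset (EuclideanSpace ℝ (Fin n))}
    [DecidableEq (EuclideanSpace ℝ (Fin n))] {ψ : Fin 8 → T} (hψ : Function.Injective ψ)
    (hedge : ∀ i, ∀ d ∈ ([1, 2, 4] : List (Fin 8)),
      IsExposedSubset T {(ψ i).1, (ψ (i ^^^ d)).1}) {Z : Fin 8 → Bool} {N : ℕ} {s t : Fin 8}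
    (hs : Z s = false) (h : cubeReach Z N s t = true) :
    JoinedWithin T {p | ∃ i, Z i = false ∧ (ψ i).1 = p} (ψ s) (ψ t) := by
  induction N generalizing s with
  | zero =>
    have : s = t := by simpa [cubeReach] using h
    exact this ▸ Relation.ReflTransGen.refl
  | succ N ih =>
    rw [cubeReach, Bool.or_eq_true, List.any_eq_true] at h
    rcases h with h | ⟨d, hd, h⟩
    · have : s = t := by simpa using h
      exact this ▸ Relation.ReflTransGen.refl
    · rw [Bool.and_eq_true, Bool.not_eq_true'] at h
      refine JoinedWithin.head ⟨s, hs, rfl⟩ ⟨s ^^^ d, h.1, rfl⟩ (fun he => ?_) (hedge s d hd)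
        (ih h.1 h.2)
      have : s = s ^^^ d := hψ (Subtype.ext he)
      have hne : ∀ a : Fin 8, ∀ b ∈ ([1, 2, 4] : List (Fin 8)), a ≠ a ^^^ b := by decide
      exact hne s d hd this

end ThreeCube

/-! ### Supporting hyperplanes and facets through three vertices. -/

section Facets

/-- A functional exposing `x` is negative on both vectors, so a nontrivial relation has coefficients
of opposite signs and puts `s` and `t` on one ray from `x`. -/
lemma InConvexPosition.linearIndependent_sub {E : Type*} [NormedAddCommGroup E] [NormedSpace ℝ E]
    {V : Finset E} (hV : InConvexPosition V) {x s t : E} (hx : x ∈ V)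
    (hs : s ∈ V) (ht : t ∈ V) (hxs : x ≠ s) (hxt : x ≠ t) (hst : s ≠ t) :
    LinearIndependent ℝ ![s - x, t - x] := by
  rw [LinearIndependent.pair_iff]
  intro a b hab
  obtain ⟨-, l, c, hl, hlt⟩ := hV x hx
  have h1 := hl x (by simp)
  have h2 := hlt s hs (by simpa using hxs.symm)
  have h3 := hlt t ht (by simpa using hxt.symm)
  have e := congrArg l hab
  simp only [map_add, map_smul, map_sub, map_zero, smul_eq_mul] at e
  rcases lt_trichotomy a 0 with ha | rfl | ha
  · have hb : 0 < b := by
      by_contra hcon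
      nlinarith
    refine absurd ?_ (hV.smul_sub_ne hx hs ht hxs.symm hxt.symm hst hb (neg_pos.2 ha))
    rw [neg_smul, neg_eq_iff_add_eq_zero, hab]
  · refine ⟨rfl, ?_⟩
    rw [zero_mul, zero_add] at e
    exact (mul_eq_zero.1 e).resolve_right (by linarith)
  · have hb : b < 0 := by
      by_contra hcon
      nlinarith
    refine absurd ?_ (hV.smul_sub_ne hx hs ht hxs.symm hxt.symm hst (neg_pos.2 hb) ha)
    rw [neg_smul, eq_neg_iff_add_eq_zero, hab]

variable {E : Type*} [NormedAddCommGroup E] [InnerProductSpace ℝ E]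

lemma eq_zero_of_inner_eq {V : Set E} {x w : E} (hx : x ∈ V) (hw : w ∈ vectorSpan ℝ V)
    (h : ∀ p ∈ V, inner ℝ w p = inner ℝ w x) : w = 0 := by
  have : vectorSpan ℝ V ≤ (ℝ ∙ w)ᗮ := by
    rw [vectorSpan_eq_span_vsub_set_right ℝ hx, Submodule.span_le]
    rintro _ ⟨p, hp, rfl⟩
    rw [SetLike.mem_coe, Submodule.mem_orthogonal_singleton_iff_inner_right]
    simp [inner_sub_right, h p hp]
  have := Submodule.mem_orthogonal_singleton_iff_inner_right.1 (this hw)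
  exact inner_self_eq_zero.1 this

lemma inner_eq_of_mem_orthogonal {x s t w : E}
    (hw : w ∈ (Submodule.span ℝ (Set.range ![s - x, t - x]))ᗮ) :
    inner ℝ w s = inner ℝ w x ∧ inner ℝ w t = inner ℝ w x := by
  have h := (Submodule.mem_orthogonal' _ _).1 hw
  have h1 := h (s - x) (Submodule.subset_span ⟨0, rfl⟩)
  have h2 := h (t - x) (Submodule.subset_span ⟨1, rfl⟩)
  rw [inner_sub_right, sub_eq_zero] at h1 h2
  exact ⟨h1, h2⟩

lemma span_le_vectorSpan {V : Set E} {x s t : E} (hx : x ∈ V) (hs : s ∈ V) (ht : t ∈ V) :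
    Submodule.span ℝ (Set.range ![s - x, t - x]) ≤ vectorSpan ℝ V := by
  rw [Submodule.span_le]
  rintro _ ⟨i, rfl⟩
  fin_cases i
  · exact vsub_mem_vectorSpan ℝ hs hx
  · exact vsub_mem_vectorSpan ℝ ht hx

variable [FiniteDimensional ℝ E]

/-- A supporting hyperplane through three vertices and a fourth point that is not coplanar with
them cuts out a facet of a `4`-polytope. -/
lemma InConvexPosition.exists_facet {V : Finset E} (hV : InConvexPosition V)
    (hd : Module.finrank ℝ (vectorSpan ℝ (V : Set E)) = 4) {x s t p u w : E} (hx : x ∈ V)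
    (hs : s ∈ V) (ht : t ∈ V) (hxs : x ≠ s) (hxt : x ≠ t) (hst : s ≠ t) (hp : p ∈ V)
    (hu : u ∈ (Submodule.span ℝ (Set.range ![s - x, t - x]))ᗮ)
    (hw : w ∈ (Submodule.span ℝ (Set.range ![s - x, t - x]))ᗮ)
    (huV : u ∈ vectorSpan ℝ (V : Set E)) (hu0 : u ≠ 0)
    (hsupp : ∀ q ∈ V, inner ℝ u x ≤ inner ℝ u q) (hup : inner ℝ u p = inner ℝ u x)
    (hwp : inner ℝ w p ≠ inner ℝ w x) :
    ∃ T, IsExposedSubset V T ∧ T ≠ V ∧ x ∈ T ∧ s ∈ T ∧ t ∈ T ∧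
      Module.finrank ℝ (vectorSpan ℝ (T : Set E)) = 3 := by
  classical
  have hT := isExposedSubset_filter_eq V (-innerSL ℝ u) (c := -inner ℝ u x)
    (fun v hv => by simpa using hsupp v hv)
  set T := V.filter fun v => (-innerSL ℝ u) v = -inner ℝ u x with hTdef
  have hmem : ∀ q, q ∈ T ↔ q ∈ V ∧ inner ℝ u q = inner ℝ u x := fun q => by simp [hTdef]
  have hus := inner_eq_of_mem_orthogonal hu
  have hxT : x ∈ T := (hmem x).2 ⟨hx, rfl⟩
  have hsT : s ∈ T := (hmem s).2 ⟨hs, hus.1⟩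
  have htT : t ∈ T := (hmem t).2 ⟨ht, hus.2⟩
  have hpT : p ∈ T := (hmem p).2 ⟨hp, hup⟩
  have hle : vectorSpan ℝ (T : Set E) ≤ vectorSpan ℝ (V : Set E) :=
    vectorSpan_mono ℝ (Finset.coe_subset.2 hT.1)
  have huT : u ∉ vectorSpan ℝ (T : Set E) := fun h =>
    hu0 (eq_zero_of_inner_eq (V := (T : Set E)) hxT h fun q hq => ((hmem q).1 hq).2)
  have h1 := Submodule.finrank_lt_finrank_of_lt (lt_of_le_of_ne hle fun h => huT (h ▸ huV))
  have hU : Module.finrank ℝ (Submodule.span ℝ (Set.range ![s - x, t - x])) = 2 := by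
    rw [finrank_span_eq_card (hV.linearIndependent_sub hx hs ht hxs hxt hst), Fintype.card_fin]
  -- The dimension lies strictly between 2 and 4: `u` is a direction of `V` but not of `T`, and `p -
  -- x` is a direction of `T` outside the plane since `w` does not vanish on it.
  have h2 := Submodule.finrank_lt_finrank_of_lt (lt_of_le_of_ne
    (span_le_vectorSpan (V := (T : Set E)) hxT hsT htT) fun h => hwp (by
      have : p - x ∈ vectorSpan ℝ (T : Set E) := vsub_mem_vectorSpan ℝ hpT hxT
      rw [← h] at this
      have := (Submodule.mem_orthogonal' _ _).1 hw _ this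
      rwa [inner_sub_right, sub_eq_zero] at this))
  refine ⟨T, hT, fun h => huT (h ▸ huV), hxT, hsT, htT, by omega⟩

/-- Three vertices of a `4`-polytope lie in a facet, or on a hyperplane that properly cuts the
polytope and has any two given vertices on the same side. -/
theorem InConvexPosition.exists_halfSpace_or_facet {V : Finset E} (hV : InConvexPosition V)
    (hd : Module.finrank ℝ (vectorSpan ℝ (V : Set E)) = 4) {x s t : E} (hx : x ∈ V)
    (hs : s ∈ V) (ht : t ∈ V) (hxs : x ≠ s) (hxt : x ≠ t) (hst : s ≠ t) (s' t' : E) :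
    (∃ f : E →L[ℝ] ℝ, f s = f x ∧ f t = f x ∧ f x ≤ f s' ∧ f x ≤ f t' ∧ (∃ p ∈ V, f p < f x) ∧
      ∃ q ∈ V, f x < f q) ∨
    ∃ T, IsExposedSubset V T ∧ T ≠ V ∧ x ∈ T ∧ s ∈ T ∧ t ∈ T ∧
      Module.finrank ℝ (vectorSpan ℝ (T : Set E)) = 3 := by
  set U := Submodule.span ℝ (Set.range ![s - x, t - x]) with hUdef
  have hU : Module.finrank ℝ U = 2 := by
    rw [hUdef, finrank_span_eq_card (hV.linearIndependent_sub hx hs ht hxs hxt hst),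
      Fintype.card_fin]
  set W := Uᗮ ⊓ vectorSpan ℝ (V : Set E) with hWdef
  have hW : Module.finrank ℝ W = 2 := by
    have := Submodule.finrank_add_inf_finrank_orthogonal
      (span_le_vectorSpan (V := (V : Set E)) hx hs ht)
    rw [← hUdef, ← hWdef, hU, hd] at this
    omega
  by_cases hcase : ∃ w ∈ W, w ≠ 0 ∧ ∀ p ∈ V, inner ℝ w x ≤ inner ℝ w p
  · right
    obtain ⟨u, huW, hu0, hsupp⟩ := hcase
    obtain ⟨w, hwW, hwu⟩ : ∃ w ∈ W, w ∉ (ℝ ∙ u) := by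
      by_contra! hcon
      have h1 := Submodule.finrank_mono (show W ≤ (ℝ ∙ u) from hcon)
      rw [finrank_span_singleton hu0] at h1
      omega
    by_cases hZ : ∃ p ∈ V, inner ℝ u p = inner ℝ u x ∧ inner ℝ w p ≠ inner ℝ w x
    · obtain ⟨p, hp, hup, hwp⟩ := hZ
      exact hV.exists_facet hd hx hs ht hxs hxt hst hp huW.1 hwW.1 huW.2 hu0 hsupp hup hwp
    · push Not at hZ
      classical
      have hne : (V.filter fun p => inner ℝ u p ≠ inner ℝ u x).Nonempty := by
        by_contra hcon
        rw [Finset.not_nonempty_iff_eq_empty, Finset.filter_eq_empty_iff] at hcon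
        exact hu0 (eq_zero_of_inner_eq (V := (V : Set E)) hx huW.2 fun q hq =>
          not_not.1 (hcon hq))
      -- The face cut out by `u` is too small here, so the hyperplane is rotated until it meets a
      -- new vertex `p`: the least ratio `r` is the largest for which `w - r • u` still supports
      -- `V`.
      obtain ⟨p, hp, hmin⟩ := Finset.exists_min_image _
        (fun p => (inner ℝ w p - inner ℝ w x) / (inner ℝ u p - inner ℝ u x)) hne
      rw [Finset.mem_filter] at hp
      set r := (inner ℝ w p - inner ℝ w x) / (inner ℝ u p - inner ℝ u x) with hr
      have hpos : ∀ q ∈ V, inner ℝ u q ≠ inner ℝ u x → 0 < inner ℝ u q - inner ℝ u x :=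
        fun q hq hne => sub_pos.2 (lt_of_le_of_ne (hsupp q hq) hne.symm)
      refine hV.exists_facet (u := w - r • u) hd hx hs ht hxs hxt hst hp.1
        (W.sub_mem hwW (W.smul_mem r huW)).1 huW.1 (W.sub_mem hwW (W.smul_mem r huW)).2
        (fun h => hwu ?_) (fun q hq => ?_) ?_ hp.2
      · rw [sub_eq_zero.1 h]
        exact Submodule.smul_mem _ _ (Submodule.mem_span_singleton_self u)
      · simp only [inner_sub_left, real_inner_smul_left]
        by_cases hq0 : inner ℝ u q = inner ℝ u x
        · rw [hq0, hZ q hq hq0]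
        · have := (le_div_iff₀ (hpos q hq hq0)).1 (hmin q (Finset.mem_filter.2 ⟨hq, hq0⟩))
          linarith
      · simp only [inner_sub_left, real_inner_smul_left]
        have : r * (inner ℝ u p - inner ℝ u x) = inner ℝ w p - inner ℝ w x :=
          div_mul_cancel₀ _ (hpos p hp.1 hp.2).ne'
        linarith
  · left
    push Not at hcase
    obtain ⟨w, hwW, hw0, hws, hwt⟩ : ∃ w ∈ W, w ≠ 0 ∧ inner ℝ w s' = inner ℝ w x ∧
        inner ℝ w x ≤ inner ℝ w t' := by
      -- One linear condition on the 2-dimensional `W` leaves a nonzero solution; its sign is still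
      -- free to place `t'`.
      have hker := LinearMap.ker_ne_bot_of_finrank_lt
        (f := ((innerSL ℝ (s' - x)).toLinearMap).comp W.subtype) (by
          rw [hW, Module.finrank_self]; norm_num)
      obtain ⟨w, hw, hw0⟩ := Submodule.exists_mem_ne_zero_of_ne_bot hker
      have hws : inner ℝ w.1 s' = inner ℝ w.1 x := by
        have : inner ℝ (s' - x) w.1 = 0 := by simpa [inner_sub_left] using hw
        rwa [real_inner_comm, inner_sub_right, sub_eq_zero] at this
      have hw0' : w.1 ≠ 0 := fun h => hw0 (Subtype.ext h)
      rcases le_total (inner ℝ w.1 x) (inner ℝ w.1 t') with h | h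
      · exact ⟨w, w.2, hw0', hws, h⟩
      · exact ⟨-w, W.neg_mem w.2, neg_ne_zero.2 hw0', by simp [hws], by simpa using h⟩
    have hst' := inner_eq_of_mem_orthogonal hwW.1
    obtain ⟨p, hp, hpx⟩ := hcase w hwW hw0
    obtain ⟨q, hq, hqx⟩ := hcase (-w) (W.neg_mem hwW) (neg_ne_zero.2 hw0)
    exact ⟨innerSL ℝ w, by simpa using hst'.1, by simpa using hst'.2, by simp [hws],
      by simpa using hwt, ⟨p, hp, by simpa using hpx⟩, ⟨q, hq, by simpa using hqx⟩⟩

end Facets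

/-! ### Linking two pairs of vertices in a cubical 4-polytope. -/

section Linked

variable {n : ℕ}

/-- In a polytope equivalent to the `3`-cube, two vertices are joined by a path that avoids any two
given points other than them. -/
lemma InConvexPosition.joinedWithin_cube {T : Finset (EuclideanSpace ℝ (Fin n))}
    [DecidableEq (EuclideanSpace ℝ (Fin n))] (hT : InConvexPosition T)
    (h : CombEquiv (convexHull ℝ (T : Set (EuclideanSpace ℝ (Fin n)))) (stdCube 3))
    {x s t y : EuclideanSpace ℝ (Fin n)} (hx : x ∈ T) (hs : s ∈ T) (ht : t ∈ T)
    (hnd : [x, s, t, y].Nodup) : JoinedWithin T {p | p ∈ T ∧ p ≠ x ∧ p ≠ y} s t := by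
  obtain ⟨ψ, hψ, hψ0, hedge⟩ := exists_cube_numbering hT h hx
  obtain ⟨i, hi⟩ := hψ.2 ⟨s, hs⟩
  obtain ⟨j, hj⟩ := hψ.2 ⟨t, ht⟩
  obtain rfl : (ψ i).1 = s := congrArg Subtype.val hi
  obtain rfl : (ψ j).1 = t := congrArg Subtype.val hj
  obtain rfl : (ψ 0).1 = x := congrArg Subtype.val hψ0
  have hinj : ∀ a b, (ψ a).1 = (ψ b).1 ↔ a = b := fun a b =>
    ⟨fun h => hψ.1 (Subtype.ext h), fun h => h ▸ rfl⟩
  -- If `y` is not in `T`, any spare vertex of the cube serves as the second one to avoid.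
  obtain ⟨k, hk, hky⟩ : ∃ k, [0, i, j, k].Nodup ∧ ∀ l, l ≠ k → (ψ l).1 ≠ y := by
    by_cases hy : y ∈ T
    · obtain ⟨k, hk⟩ := hψ.2 ⟨y, hy⟩
      obtain rfl : (ψ k).1 = y := congrArg Subtype.val hk
      refine ⟨k, ?_, fun l hl h => hl ((hinj _ _).1 h)⟩
      simpa [hinj] using hnd
    · have hex : ∀ a b : Fin 8, [0, a, b].Nodup → ∃ k, [0, a, b, k].Nodup := by decide +kernel
      obtain ⟨k, hk⟩ := hex i j (by
        simp only [List.nodup_cons, List.mem_cons, hinj, List.not_mem_nil, not_or] at hnd ⊢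
        tauto)
      exact ⟨k, hk, fun l _ h => hy (h ▸ (ψ l).2)⟩
  have hik : i ≠ 0 ∧ i ≠ k := by
    simp only [List.nodup_cons, List.mem_cons, List.not_mem_nil, not_or] at hk
    exact ⟨fun h => hk.1.1 h.symm, hk.2.1.2.1⟩
  have := joinedWithin_of_cubeReach hψ.1 hedge (by simp [hik]) (cubeReach_of_nodup i j k hk)
  refine JoinedWithin.mono (.refl T) ?_ this
  rintro _ ⟨l, hl, rfl⟩
  simp only [Bool.or_eq_false_iff, beq_eq_false_iff_ne] at hl
  exact ⟨(ψ l).2, fun h => hl.1 ((hinj _ _).1 h), hky l hl.2⟩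

/-- Among five vertices of a `3`-cube, one of two pairs is joined by a path that avoids the other
three vertices. -/
lemma InConvexPosition.joinedWithin_cube_or {T : Finset (EuclideanSpace ℝ (Fin n))}
    [DecidableEq (EuclideanSpace ℝ (Fin n))] (hT : InConvexPosition T)
    (h : CombEquiv (convexHull ℝ (T : Set (EuclideanSpace ℝ (Fin n)))) (stdCube 3))
    {x s t s' t' : EuclideanSpace ℝ (Fin n)} (hx : x ∈ T) (hs : s ∈ T) (ht : t ∈ T)
    (hs' : s' ∈ T) (ht' : t' ∈ T) (hnd : [x, s, t, s', t'].Nodup) :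
    JoinedWithin T {p | p ∈ T ∧ p ≠ x ∧ p ≠ s' ∧ p ≠ t'} s t ∨
      JoinedWithin T {p | p ∈ T ∧ p ≠ x ∧ p ≠ s ∧ p ≠ t} s' t' := by
  obtain ⟨ψ, hψ, hψ0, hedge⟩ := exists_cube_numbering hT h hx
  obtain ⟨i, hi⟩ := hψ.2 ⟨s, hs⟩
  obtain ⟨j, hj⟩ := hψ.2 ⟨t, ht⟩
  obtain ⟨i', hi'⟩ := hψ.2 ⟨s', hs'⟩
  obtain ⟨j', hj'⟩ := hψ.2 ⟨t', ht'⟩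
  obtain rfl : (ψ i).1 = s := congrArg Subtype.val hi
  obtain rfl : (ψ j).1 = t := congrArg Subtype.val hj
  obtain rfl : (ψ i').1 = s' := congrArg Subtype.val hi'
  obtain rfl : (ψ j').1 = t' := congrArg Subtype.val hj'
  obtain rfl : (ψ 0).1 = x := congrArg Subtype.val hψ0
  have hinj : ∀ a b, (ψ a).1 = (ψ b).1 ↔ a = b := fun a b =>
    ⟨fun h => hψ.1 (Subtype.ext h), fun h => h ▸ rfl⟩
  have hnd' : [0, i, j, i', j'].Nodup := by simpa [hinj] using hnd
  have key : ∀ a b c d : Fin 8, c ≠ 0 → c ≠ a → c ≠ b →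
      cubeReach (fun z => z == 0 || z == a || z == b) 4 c d = true →
      JoinedWithin T {p | p ∈ T ∧ p ≠ ψ 0 ∧ p ≠ ψ a ∧ p ≠ ψ b} (ψ c) (ψ d) := by
    intro a b c d h0 ha hb hr
    refine JoinedWithin.mono (.refl T) ?_ (joinedWithin_of_cubeReach hψ.1 hedge
      (by simp [h0, ha, hb]) hr)
    rintro _ ⟨l, hl, rfl⟩
    simp only [Bool.or_eq_false_iff, beq_eq_false_iff_ne] at hl
    exact ⟨(ψ l).2, fun h => hl.1.1 ((hinj _ _).1 h), fun h => hl.1.2 ((hinj _ _).1 h),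
      fun h => hl.2 ((hinj _ _).1 h)⟩
  have hr := cubeReach_or i j i' j' hnd'
  simp only [List.nodup_cons, List.mem_cons, List.not_mem_nil, not_or, or_false] at hnd'
  obtain ⟨⟨h1, h2, h3, h4⟩, ⟨h5, h6, h7⟩, ⟨h8, h9⟩, h10, -⟩ := hnd'
  exact hr.imp (key i' j' i j (Ne.symm h1) h6 h7)
    (key i j i' j' (Ne.symm h3) (Ne.symm h6) (Ne.symm h8))

/-- A path inside a proper face and a path outside of it link two pairs of vertices. -/
lemma InConvexPosition.linkedAvoiding_of_joinedWithin {V T : Finset (EuclideanSpace ℝ (Fin n))}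
    [DecidableEq (EuclideanSpace ℝ (Fin n))] (hV : InConvexPosition V) (hT : IsExposedSubset V T)
    (hTV : T ≠ V) {S : Set (EuclideanSpace ℝ (Fin n))} (hST : S ⊆ T)
    {x s t s' t' : EuclideanSpace ℝ (Fin n)} (hx : x ∈ T) (hs' : s' ∈ V) (ht' : t' ∈ V)
    (hxs' : x ≠ s') (hxt' : x ≠ t') (hxS : x ∉ S) (hsS : s ∈ S) (hs'S : s' ∉ S) (ht'S : t' ∉ S)
    (h : JoinedWithin T S s t) : LinkedAvoiding V x s t s' t' := by
  have hTV' := hT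
  obtain ⟨hsub, l, c, hl, hlt⟩ := hT
  obtain ⟨q, hq, hqT⟩ := Finset.exists_of_ssubset (hsub.ssubset_of_ne hTV)
  have hle : ∀ v ∈ V, l v ≤ c := fun v hv => by
    by_cases h : v ∈ T
    · exact (hl v h).le
    · exact (hlt v hv h).le
  refine ⟨S, _, ?_, hxS, ?_, hsS, ?_, h.mono hTV' subset_rfl,
    hV.joinedWithin_halfSpace (-l) (-c) hs' ht' hq (by simpa using hle s' hs')
      (by simpa using hle t' ht') (by simpa using hlt q hq hqT)⟩
  · rw [Set.disjoint_left]
    rintro y hy ((rfl | rfl) | ⟨-, hyc⟩)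
    · exact hs'S hy
    · exact ht'S hy
    · simp [hl y (hST hy)] at hyc
  · rintro ((h | h) | ⟨-, hxc⟩)
    · exact hxs' h
    · exact hxt' h
    · simp [hl x hx] at hxc
  · simp

/-- If all five vertices lie in the facet, `joinedWithin_cube_or` decides which pair is joined
inside. Otherwise at most one of `s', t'` lies in it, and removing that vertex and `x` leaves `s, t`
connected in the cube. -/
lemma InConvexPosition.linkedAvoiding_of_facet {V T : Finset (EuclideanSpace ℝ (Fin n))}
    [DecidableEq (EuclideanSpace ℝ (Fin n))] (hV : InConvexPosition V) (hT : IsExposedSubset V T)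
    (hTV : T ≠ V)
    (h : CombEquiv (convexHull ℝ (T : Set (EuclideanSpace ℝ (Fin n)))) (stdCube 3))
    {x s t s' t' : EuclideanSpace ℝ (Fin n)} (hx : x ∈ T) (hs : s ∈ T) (ht : t ∈ T) (hs' : s' ∈ V)
    (ht' : t' ∈ V) (hnd : [x, s, t, s', t'].Nodup) : LinkedAvoiding V x s t s' t' := by
  have hnd' := hnd
  simp only [List.nodup_cons, List.mem_cons, List.not_mem_nil, not_or, or_false] at hnd'
  obtain ⟨⟨h1, h2, h3, h4⟩, ⟨h5, h6, h7⟩, ⟨h8, h9⟩, h10, -⟩ := hnd'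
  have hT' := hV.subset hT.1
  by_cases hs'T : s' ∈ T
  · by_cases ht'T : t' ∈ T
    · rcases hT'.joinedWithin_cube_or h hx hs ht hs'T ht'T hnd with hj | hj
      · exact hV.linkedAvoiding_of_joinedWithin hT hTV
          (S := {p | p ∈ T ∧ p ≠ x ∧ p ≠ s' ∧ p ≠ t'}) (fun p hp => hp.1) hx hs' ht' h3 h4
          (fun h => h.2.1 rfl) ⟨hs, Ne.symm h1, h6, h7⟩ (fun h => h.2.2.1 rfl)
          (fun h => h.2.2.2 rfl) hj
      · exact (hV.linkedAvoiding_of_joinedWithin hT hTV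
          (S := {p | p ∈ T ∧ p ≠ x ∧ p ≠ s ∧ p ≠ t}) (fun p hp => hp.1) hx (hT.1 hs) (hT.1 ht)
          h1 h2 (fun h => h.2.1 rfl) ⟨hs'T, Ne.symm h3, Ne.symm h6, Ne.symm h8⟩
          (fun h => h.2.2.1 rfl) (fun h => h.2.2.2 rfl) hj).swap
    · refine hV.linkedAvoiding_of_joinedWithin hT hTV
        (S := {p | p ∈ T ∧ p ≠ x ∧ p ≠ s'}) (fun p hp => hp.1) hx hs' ht' h3 h4
        (fun h => h.2.1 rfl) ⟨hs, Ne.symm h1, h6⟩ (fun h => h.2.2 rfl) (fun h => ht'T h.1)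
        (hT'.joinedWithin_cube h hx hs ht (y := s') ?_)
      simp [h1, h2, h3, h5, h6, h8]
  · refine hV.linkedAvoiding_of_joinedWithin hT hTV
      (S := {p | p ∈ T ∧ p ≠ x ∧ p ≠ t'}) (fun p hp => hp.1) hx hs' ht' h3 h4
      (fun h => h.2.1 rfl) ⟨hs, Ne.symm h1, h7⟩ (fun h => hs'T h.1) (fun h => h.2.2 rfl)
      (hT'.joinedWithin_cube h hx hs ht (y := t') ?_)
    simp [h1, h2, h4, h5, h7, h9]

lemma InConvexPosition.linkedAvoiding_of_cubical {V : Finset (EuclideanSpace ℝ (Fin n))}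
    [DecidableEq (EuclideanSpace ℝ (Fin n))] (hV : InConvexPosition V)
    (hP : IsCubicalDPolytope 4 (convexHull ℝ (V : Set (EuclideanSpace ℝ (Fin n)))))
    {x s t s' t' : EuclideanSpace ℝ (Fin n)} (hx : x ∈ V) (hs : s ∈ V) (ht : t ∈ V) (hs' : s' ∈ V)
    (ht' : t' ∈ V) (hnd : [x, s, t, s', t'].Nodup) : LinkedAvoiding V x s t s' t' := by
  obtain ⟨⟨-, -, hd⟩, hfacet⟩ := hP
  have hspan : ∀ S : Set (EuclideanSpace ℝ (Fin n)),
      vectorSpan ℝ (convexHull ℝ S) = vectorSpan ℝ S := fun S => by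
    rw [← direction_affineSpan, affineSpan_convexHull, direction_affineSpan]
  rw [hspan] at hd
  have hnd' := hnd
  simp only [List.nodup_cons, List.mem_cons, List.not_mem_nil, not_or, or_false] at hnd'
  rcases hV.exists_halfSpace_or_facet hd hx hs ht hnd'.1.1 hnd'.1.2.1 hnd'.2.1.1 s' t' with
    ⟨f, h1, h2, h3, h4, ⟨p, hp, hpx⟩, q, hq, hqx⟩ | ⟨T, hT, hTV, hxT, hsT, htT, hdT⟩
  · exact hV.linkedAvoiding_of_halfSpace f hs ht hs' ht' hp hq hnd h1 h2 h3 h4 hpx hqx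
  · refine hV.linkedAvoiding_of_facet hT hTV (hfacet _ hT.isExposed 3 rfl ⟨⟨x, ?_⟩, ?_⟩) hxT hsT htT
      hs' ht' hnd
    · exact subset_convexHull ℝ _ hxT
    · rw [hspan, hdT]

end Linked

/-! ### From edge relations on points to paths in the polytope graph. -/

section Graph

variable {n : ℕ}

lemma InConvexPosition.vertexSet_eq {V : Finset (EuclideanSpace ℝ (Fin n))}
    (hV : InConvexPosition V) :
    vertexSet (convexHull ℝ (V : Set (EuclideanSpace ℝ (Fin n)))) = V := by
  ext v
  rw [vertexSet, mem_exposedPoints_iff_exposed_singleton, isExposed_singleton_iff]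
  exact ⟨fun h => h.1 (Finset.mem_singleton_self v), fun h => hV v h⟩

lemma InConvexPosition.mem_of_mem_vertexSet {V : Finset (EuclideanSpace ℝ (Fin n))}
    (hV : InConvexPosition V) {v : EuclideanSpace ℝ (Fin n)}
    (hv : v ∈ vertexSet (convexHull ℝ (V : Set (EuclideanSpace ℝ (Fin n))))) : v ∈ V := by
  rw [hV.vertexSet_eq] at hv
  exact hv

lemma vectorSpan_convexHull (S : Set (EuclideanSpace ℝ (Fin n))) :
    vectorSpan ℝ (convexHull ℝ S) = vectorSpan ℝ S := by
  rw [← direction_affineSpan, affineSpan_convexHull, direction_affineSpan]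

lemma InConvexPosition.adj_iff {V : Finset (EuclideanSpace ℝ (Fin n))}
    [DecidableEq (EuclideanSpace ℝ (Fin n))] (hV : InConvexPosition V)
    (u v : vertexSet (convexHull ℝ (V : Set (EuclideanSpace ℝ (Fin n))))) :
    (polytopeGraph _).Adj u v ↔ u ≠ v ∧ IsExposedSubset V {u.1, v.1} := by
  have hu : u.1 ∈ V := hV.mem_of_mem_vertexSet u.2
  have hv : v.1 ∈ V := hV.mem_of_mem_vertexSet v.2
  rw [← hV.isExposed_segment_iff hu hv]
  rfl

/-- The chain of edges is a walk, and shortening it to a path only shrinks its support. That `u`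
lies in `S` must be assumed for the trivial chain. -/
lemma InConvexPosition.exists_path {V : Finset (EuclideanSpace ℝ (Fin n))}
    [DecidableEq (EuclideanSpace ℝ (Fin n))] (hV : InConvexPosition V)
    {S : Set (EuclideanSpace ℝ (Fin n))}
    (u w : vertexSet (convexHull ℝ (V : Set (EuclideanSpace ℝ (Fin n))))) (hu : u.1 ∈ S)
    (h : JoinedWithin V S u w) :
    ∃ L : (polytopeGraph _).Path u w, ∀ z ∈ L.1.support, z.1 ∈ S := by
  classical
  suffices ∃ p : (polytopeGraph _).Walk u w, ∀ z ∈ p.support, z.1 ∈ S by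
    obtain ⟨p, hp⟩ := this
    exact ⟨p.toPath, fun z hz => hp z (p.support_toPath_subset_support hz)⟩
  obtain ⟨u, hu'⟩ := u
  simp only at h hu
  induction h using Relation.ReflTransGen.head_induction_on with
  | refl => exact ⟨.nil, by simpa using hu⟩
  | @head a b hab _ ih =>
    obtain ⟨-, hb, hne, he⟩ := hab
    have hbV : b ∈ vertexSet (convexHull ℝ (V : Set (EuclideanSpace ℝ (Fin n)))) := by
      rw [hV.vertexSet_eq]
      exact he.1 (by simp)
    obtain ⟨p, hp⟩ := ih hbV hb
    refine ⟨.cons ((hV.adj_iff ⟨a, hu'⟩ ⟨b, hbV⟩).2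
      ⟨fun h => hne (congrArg Subtype.val h), he⟩) p, fun z hz => ?_⟩
    rw [SimpleGraph.Walk.support_cons, List.mem_cons] at hz
    rcases hz with rfl | hz
    · exact hu
    · exact hp z hz

lemma HasDim.succ_le_card {V : Finset (EuclideanSpace ℝ (Fin n))} {d : ℕ}
    (hd : HasDim d (convexHull ℝ (V : Set (EuclideanSpace ℝ (Fin n))))) : d + 1 ≤ V.card := by
  classical
  obtain ⟨hne, hd⟩ := hd
  rw [vectorSpan_convexHull] at hd
  have hpos : V.Nonempty := by simpa using hne
  have := finrank_vectorSpan_image_finset_le ℝ (id : EuclideanSpace ℝ (Fin n) → _) V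
    (n := V.card - 1) (Nat.succ_pred_eq_of_pos hpos.card_pos).symm
  rw [Finset.image_id, hd] at this
  have := hpos.card_pos
  omega

/-- Every cubical `4`-polytope is strongly `2`-linked. -/
theorem isStronglyLinked_of_cubical {P : Set (EuclideanSpace ℝ (Fin n))}
    (hP : IsCubicalDPolytope 4 P) : IsStronglyLinked 4 2 P := by
  classical
  obtain ⟨S, hS⟩ := hP.1.1
  obtain ⟨V, -, hVS, hV⟩ := exists_inConvexPosition S
  obtain rfl : P = convexHull ℝ (V : Set (EuclideanSpace ℝ (Fin n))) := hS.trans hVS.symm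
  refine ⟨?_, fun X hX s t hinj hs ht => ?_⟩
  · rw [hV.vertexSet_eq, Set.encard_coe_eq_coe_finsetCard]
    exact_mod_cast hP.1.2.succ_le_card
  have hmem : ∀ u : vertexSet (convexHull ℝ (V : Set (EuclideanSpace ℝ (Fin n)))), u.1 ∈ V :=
    fun u => hV.mem_of_mem_vertexSet u.2
  have hss : s 0 ≠ s 1 := fun h => by simpa using hinj (a₁ := .inl 0) (a₂ := .inl 1) h
  have htt : t 0 ≠ t 1 := fun h => by simpa using hinj (a₁ := .inr 0) (a₂ := .inr 1) h
  have hst : ∀ i j, s i ≠ t j := fun i j h => by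
    simpa using hinj (a₁ := .inl i) (a₂ := .inr j) h
  have hcard : (X \ {s 0, t 0, s 1, t 1}).card = 1 := by
    rw [Finset.card_sdiff_of_subset, hX]
    · rw [Finset.card_insert_of_notMem, Finset.card_insert_of_notMem, Finset.card_insert_of_notMem,
        Finset.card_singleton]
      · simpa using hst 1 1
      · simpa using ⟨(hst 1 0).symm, htt⟩
      · simpa using ⟨hst 0 0, hss, hst 0 1⟩
    · intro y hy
      simp only [Finset.mem_insert, Finset.mem_singleton] at hy
      rcases hy with rfl | rfl | rfl | rfl <;> simp [hs, ht]
  obtain ⟨x, hx⟩ := Finset.card_eq_one.1 hcard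
  have hxX : ∀ y, y ∈ X ∧ (∀ i, y ≠ s i ∧ y ≠ t i) ↔ y = x := fun y => by
    have := congrArg (y ∈ ·) hx
    simp only [Finset.mem_sdiff, Finset.mem_insert, Finset.mem_singleton, eq_iff_iff] at this
    rw [← this, Fin.forall_fin_two]
    tauto
  have hx' := ((hxX x).2 rfl).2
  have hnd : [x.1, (s 0).1, (t 0).1, (s 1).1, (t 1).1].Nodup := by
    have : [x, s 0, t 0, s 1, t 1].Nodup := by
      simp [(hx' 0).1, (hx' 0).2, (hx' 1).1, (hx' 1).2, hst, hss, htt, (hst _ _).symm]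
    exact this.map Subtype.val_injective
  obtain ⟨A, B, hAB, hxA, hxB, hsA, hsB, hA, hB⟩ := hV.linkedAvoiding_of_cubical hP (hmem _) (hmem _)
    (hmem _) (hmem _) (hmem _) hnd
  obtain ⟨L, hL⟩ := hV.exists_path (s 0) (t 0) hsA hA
  obtain ⟨M, hM⟩ := hV.exists_path (s 1) (t 1) hsB hB
  refine ⟨Fin.cons L (Fin.cons M fun i => i.elim0), ?_, fun y hyX hy => ?_⟩
  · rw [Fin.forall_fin_two, Fin.forall_fin_two, Fin.forall_fin_two]
    refine ⟨⟨fun h => absurd rfl h, fun _ v hv hv' => ?_⟩, ⟨fun _ v hv hv' => ?_,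
      fun h => absurd rfl h⟩⟩
    · exact Set.disjoint_left.1 hAB (hL v hv) (hM v hv')
    · exact Set.disjoint_left.1 hAB (hL v hv') (hM v hv)
  · obtain rfl := (hxX y).1 ⟨hyX, hy⟩
    rw [Fin.forall_fin_two]
    exact ⟨fun h => hxA (hL y h), fun h => hxB (hM y h)⟩

end Graph

/-! ### Two-fold pyramids over quadrangles are not strongly 2-linked. -/

section Pyramid

variable {n : ℕ}

lemma eq_of_mem_affineSpan {S : Set (EuclideanSpace ℝ (Fin n))}
    {l : EuclideanSpace ℝ (Fin n) →L[ℝ] ℝ} {c : ℝ} (h : ∀ v ∈ S, l v = c)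
    {x : EuclideanSpace ℝ (Fin n)} (hx : x ∈ affineSpan ℝ S) : l x = c := by
  refine affineSpan_induction (p := fun x => l x = c) hx h fun r u v w hu hv hw => ?_
  simp [hu, hv, hw]

lemma exists_functional_of_notMem_affineSpan {S : Set (EuclideanSpace ℝ (Fin n))}
    (hS : S.Nonempty) {a : EuclideanSpace ℝ (Fin n)} (ha : a ∉ affineSpan ℝ S) :
    ∃ (l : EuclideanSpace ℝ (Fin n) →L[ℝ] ℝ) (c : ℝ), (∀ v ∈ S, l v = c) ∧ c < l a := by
  obtain ⟨p, hp⟩ := hS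
  have hap : a - p ∉ vectorSpan ℝ S := fun h => ha <| by
    rw [← direction_affineSpan] at h
    exact (AffineSubspace.vsub_right_mem_direction_iff_mem (mem_affineSpan ℝ hp) a).1 h
  rw [← Submodule.orthogonal_orthogonal (vectorSpan ℝ S), Submodule.mem_orthogonal] at hap
  push Not at hap
  obtain ⟨w, hw, hne⟩ := hap
  have hconst : ∀ u ∈ (vectorSpan ℝ S)ᗮ, ∀ v ∈ S, inner ℝ u v = inner ℝ u p := fun u hu v hv => by
    have := (Submodule.mem_orthogonal' _ _).1 hu _ (vsub_mem_vectorSpan ℝ hv hp)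
    rwa [vsub_eq_sub, inner_sub_right, sub_eq_zero] at this
  rw [inner_sub_right, sub_ne_zero] at hne
  rcases lt_or_gt_of_ne hne with h | h
  · exact ⟨innerSL ℝ (-w), inner ℝ (-w) p, hconst (-w) (Submodule.neg_mem _ hw), by simpa using h⟩
  · exact ⟨innerSL ℝ w, inner ℝ w p, hconst w hw, h⟩

/-- Adding an apex outside of the affine hull preserves convex position. -/
lemma InConvexPosition.insert {V : Finset (EuclideanSpace ℝ (Fin n))}
    [DecidableEq (EuclideanSpace ℝ (Fin n))] (hV : InConvexPosition V) (hne : V.Nonempty)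
    {a : EuclideanSpace ℝ (Fin n)}
    (ha : a ∉ affineSpan ℝ (V : Set (EuclideanSpace ℝ (Fin n)))) :
    InConvexPosition (insert a V) := by
  obtain ⟨k, d, hk, hka⟩ := exists_functional_of_notMem_affineSpan
    (S := (V : Set (EuclideanSpace ℝ (Fin n)))) hne ha
  intro v hv
  refine ⟨Finset.singleton_subset_iff.2 hv, ?_⟩
  rcases Finset.mem_insert.1 hv with rfl | hvV
  · refine ⟨k, k v, by simp, fun u hu huv => ?_⟩
    rw [hk u ((Finset.mem_insert.1 hu).resolve_left (by simpa using huv))]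
    exact hka
  · obtain ⟨-, l, c, hl, hlt⟩ := hV v hvV
    -- As `k` is constant on `V`, subtracting `r • k` only shifts `l` there; for large `r` it pushes
    -- the apex below the bound.
    obtain ⟨r, hr⟩ := exists_gt ((l a - c) / (k a - d))
    rw [div_lt_iff₀ (sub_pos.2 hka)] at hr
    refine ⟨l - r • k, c - r * d, fun u hu => ?_, fun u hu huv => ?_⟩
    · rw [Finset.mem_singleton.1 hu]
      simp [hl v (by simp), hk v hvV]
    simp only [sub_apply, smul_apply, smul_eq_mul]
    rcases Finset.mem_insert.1 hu with rfl | huV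
    · linarith
    · rw [hk u huV]
      linarith [hlt u huV huv]

lemma finrank_vectorSpan_insert {S : Set (EuclideanSpace ℝ (Fin n))} (hS : S.Nonempty)
    {a : EuclideanSpace ℝ (Fin n)} (ha : a ∉ affineSpan ℝ S) :
    Module.finrank ℝ (vectorSpan ℝ (insert a S)) = Module.finrank ℝ (vectorSpan ℝ S) + 1 := by
  obtain ⟨p, hp⟩ := hS
  refine le_antisymm (finrank_vectorSpan_insert_le_set ℝ S a) ?_
  refine Submodule.finrank_lt_finrank_of_lt (lt_of_le_of_ne
    (vectorSpan_mono ℝ (Set.subset_insert a S)) fun h => ha ?_)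
  have hap : a -ᵥ p ∈ vectorSpan ℝ (insert a S) :=
    vsub_mem_vectorSpan ℝ (Set.mem_insert a S) (Set.mem_insert_of_mem a hp)
  rw [← h, ← direction_affineSpan] at hap
  exact (AffineSubspace.vsub_right_mem_direction_iff_mem (mem_affineSpan ℝ hp) a).1 hap

lemma IsPyramid.exists_insert {V : Finset (EuclideanSpace ℝ (Fin n))}
    [DecidableEq (EuclideanSpace ℝ (Fin n))] (hV : InConvexPosition V) (hne : V.Nonempty)
    {R : Set (EuclideanSpace ℝ (Fin n))}
    (hR : IsPyramid R (convexHull ℝ (V : Set (EuclideanSpace ℝ (Fin n))))) :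
    ∃ a ∉ V, R = convexHull ℝ ((insert a V : Finset _) : Set (EuclideanSpace ℝ (Fin n))) ∧
      InConvexPosition (insert a V) ∧
      Module.finrank ℝ (vectorSpan ℝ ((insert a V : Finset _) : Set (EuclideanSpace ℝ (Fin n)))) =
        Module.finrank ℝ (vectorSpan ℝ (V : Set (EuclideanSpace ℝ (Fin n)))) + 1 := by
  obtain ⟨a, ha, rfl⟩ := hR
  rw [affineSpan_convexHull] at ha
  refine ⟨a, fun h => ha (mem_affineSpan ℝ h), ?_, hV.insert hne ha, ?_⟩
  · rw [Finset.coe_insert]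
    refine Set.Subset.antisymm (convexHull_min (Set.insert_subset ?_ ?_) (convex_convexHull ℝ _))
      (convexHull_mono (Set.insert_subset_insert (subset_convexHull ℝ _)))
    · exact subset_convexHull ℝ _ (Set.mem_insert _ _)
    · exact convexHull_mono (Set.subset_insert _ _)
  · rw [Finset.coe_insert]
    exact finrank_vectorSpan_insert hne ha

lemma isDPolytope_convexHull {V : Finset (EuclideanSpace ℝ (Fin n))} (hne : V.Nonempty)
    {d : ℕ} (hd : Module.finrank ℝ (vectorSpan ℝ (V : Set (EuclideanSpace ℝ (Fin n)))) = d) :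
    IsDPolytope d (convexHull ℝ (V : Set (EuclideanSpace ℝ (Fin n)))) :=
  ⟨⟨V, rfl⟩, convexHull_nonempty_iff.2 hne, by rw [vectorSpan_convexHull, hd]⟩

/-- The vertices of a quadrangle are the ends of two crossing diagonals. -/
lemma InConvexPosition.exists_crossing {V : Finset (EuclideanSpace ℝ (Fin n))}
    [DecidableEq (EuclideanSpace ℝ (Fin n))] (hV : InConvexPosition V) (hcard : V.card = 4)
    (hd : Module.finrank ℝ (vectorSpan ℝ (V : Set (EuclideanSpace ℝ (Fin n)))) = 2) :
    ∃ A B : Finset (EuclideanSpace ℝ (Fin n)), A.card = 2 ∧ B.card = 2 ∧ Disjoint A B ∧ A ∪ B = V ∧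
      (convexHull ℝ (A : Set (EuclideanSpace ℝ (Fin n))) ∩
        convexHull ℝ (B : Set (EuclideanSpace ℝ (Fin n)))).Nonempty := by
  classical
  have hindep : ¬ AffineIndependent ℝ ((↑) : V → EuclideanSpace ℝ (Fin n)) := by
    rw [affineIndependent_iff_finrank_vectorSpan_eq ℝ _ (n := 3) (by simp [hcard])]
    have hrange : Set.range ((↑) : V → EuclideanSpace ℝ (Fin n)) = V := by simp
    rw [hrange, hd]
    norm_num
  -- Neither Radon part is a single point, since a vertex is not in the hull of other vertices; so
  -- four points split two and two.
  obtain ⟨I, z, hzA, hzB⟩ := Convex.radon_partition hindep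
  set A := V.filter fun v => v ∈ ((↑) : V → EuclideanSpace ℝ (Fin n)) '' I with hA
  have hzA' : z ∈ convexHull ℝ (A : Set (EuclideanSpace ℝ (Fin n))) := by
    refine convexHull_mono ?_ hzA
    rintro _ ⟨v, hv, rfl⟩
    exact Finset.mem_coe.2 (Finset.mem_filter.2 ⟨v.2, v, hv, rfl⟩)
  have hzB' : z ∈ convexHull ℝ ((V \ A : Finset _) : Set (EuclideanSpace ℝ (Fin n))) := by
    refine convexHull_mono ?_ hzB
    rintro _ ⟨v, hv, rfl⟩
    refine Finset.mem_coe.2 (Finset.mem_sdiff.2 ⟨v.2, fun h => ?_⟩)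
    obtain ⟨w, hw, hwv⟩ := (Finset.mem_filter.1 h).2
    exact hv (Subtype.ext hwv ▸ hw)
  have hAV : A ⊆ V := Finset.filter_subset _ _
  have key : ∀ C D : Finset (EuclideanSpace ℝ (Fin n)), C ⊆ V → D ⊆ V → Disjoint C D →
      z ∈ convexHull ℝ (C : Set (EuclideanSpace ℝ (Fin n))) →
      z ∈ convexHull ℝ (D : Set (EuclideanSpace ℝ (Fin n))) → 2 ≤ C.card := by
    intro C D hC hD hCD hzC hzD
    by_contra! hcon
    have : C.card = 0 ∨ C.card = 1 := by omega
    rcases this with h | h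
    · rw [Finset.card_eq_zero] at h
      simp [h] at hzC
    · obtain ⟨v, rfl⟩ := Finset.card_eq_one.1 h
      rw [Finset.coe_singleton, convexHull_singleton, Set.mem_singleton_iff] at hzC
      subst hzC
      rw [Finset.singleton_subset_iff] at hC
      exact Finset.disjoint_singleton_left.1 hCD (hV.mem_of_mem_convexHull hD hC hzD)
  have h1 := key A (V \ A) hAV Finset.sdiff_subset Finset.disjoint_sdiff hzA' hzB'
  have h2 := key (V \ A) A Finset.sdiff_subset hAV Finset.sdiff_disjoint hzB' hzA'
  have h3 := Finset.card_sdiff_add_card_eq_card hAV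
  exact ⟨A, V \ A, by omega, by omega, Finset.disjoint_sdiff, Finset.union_sdiff_of_subset hAV,
    z, hzA', hzB'⟩

/-- A functional exposing `A` would be both equal to its bound and strictly below it at a common
point of the two hulls. -/
lemma not_isExposedSubset_of_crossing {V A B : Finset (EuclideanSpace ℝ (Fin n))} (hB : B ⊆ V)
    (hAB : Disjoint A B) (h : (convexHull ℝ (A : Set (EuclideanSpace ℝ (Fin n))) ∩
      convexHull ℝ (B : Set (EuclideanSpace ℝ (Fin n)))).Nonempty) : ¬ IsExposedSubset V A := by
  rintro ⟨-, l, c, hl, hlt⟩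
  obtain ⟨z, hzA, hzB⟩ := h
  refine (convexHull_min (t := {y | l y < c}) (fun v hv => ?_)
    (convex_halfSpace_lt l.toLinearMap.isLinear c) hzB : l z < c).ne (eq_of_mem_convexHull hl hzA)
  exact hlt v (hB hv) fun h => Finset.disjoint_left.1 hAB h hv

lemma exists_mem_support_of_not_adj {α : Type*} {G : SimpleGraph α} {u w : α} (huw : u ≠ w)
    (h : ¬ G.Adj u w) (p : G.Walk u w) : ∃ v ∈ p.support, v ≠ u ∧ v ≠ w := by
  cases p with
  | nil => exact absurd rfl huw
  | @cons _ v _ hadj q =>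
    exact ⟨v, by simp, hadj.ne.symm, fun hvw => h (hvw ▸ hadj)⟩

/-- A two-fold pyramid over a quadrangle is a `4`-polytope with six vertices that is not strongly
`2`-linked. -/
theorem IsTwoFoldPyramid.not_isStronglyLinked {P Q : Set (EuclideanSpace ℝ (Fin n))}
    (hQ : IsQuadrangle Q) (hP : IsTwoFoldPyramid P Q) :
    IsDPolytope 4 P ∧ (vertexSet P).encard = 6 ∧ ¬ IsStronglyLinked 4 2 P := by
  classical
  obtain ⟨⟨⟨S, hS⟩, -, hdim⟩, hfour⟩ := hQ
  obtain ⟨V, -, hVS, hV⟩ := exists_inConvexPosition S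
  obtain rfl : Q = convexHull ℝ (V : Set (EuclideanSpace ℝ (Fin n))) := hS.trans hVS.symm
  rw [vectorSpan_convexHull] at hdim
  rw [hV.vertexSet_eq, Set.encard_coe_eq_coe_finsetCard] at hfour
  replace hfour : V.card = 4 := by exact_mod_cast hfour
  have hVne : V.Nonempty := Finset.card_pos.1 (by omega)
  obtain ⟨R, hR, hP⟩ := hP
  obtain ⟨a, haV, rfl, hV', hd'⟩ := IsPyramid.exists_insert hV hVne hR
  obtain ⟨b, hb, rfl, hW, hd⟩ := IsPyramid.exists_insert hV' (Finset.insert_nonempty a V) hP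
  rw [hd', hdim] at hd
  refine ⟨isDPolytope_convexHull (Finset.insert_nonempty _ _) hd, ?_, fun hlink => ?_⟩
  · rw [hW.vertexSet_eq, Set.encard_coe_eq_coe_finsetCard, Finset.card_insert_of_notMem hb,
      Finset.card_insert_of_notMem haV, hfour]
    norm_num
  obtain ⟨A, B, hA, hB, hAB, rfl, hcross⟩ := hV.exists_crossing hfour hdim
  have hsub : A ∪ B ⊆ insert b (insert a (A ∪ B)) :=
    (Finset.subset_insert _ _).trans (Finset.subset_insert _ _)
  have hnA := not_isExposedSubset_of_crossing (Finset.subset_union_right.trans hsub) hAB hcross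
  have hnB := not_isExposedSubset_of_crossing (Finset.subset_union_left.trans hsub) hAB.symm
    (Set.inter_comm _ _ ▸ hcross)
  obtain ⟨q₁, q₃, h13, rfl⟩ := Finset.card_eq_two.1 hA
  obtain ⟨q₂, q₄, h24, rfl⟩ := Finset.card_eq_two.1 hB
  simp only [Finset.mem_insert, Finset.mem_union, Finset.mem_singleton, not_or,
    Finset.disjoint_insert_left, Finset.disjoint_singleton_left] at haV hb hAB
  set W : Finset (EuclideanSpace ℝ (Fin n)) := insert b (insert a ({q₁, q₃} ∪ {q₂, q₄})) with hWdef
  have hmem : ∀ v, v ∈ W ↔ v = b ∨ v = a ∨ (v = q₁ ∨ v = q₃) ∨ v = q₂ ∨ v = q₄ := fun v => by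
    simp only [hWdef, Finset.mem_insert, Finset.mem_union, Finset.mem_singleton]
  have hvs := hW.vertexSet_eq
  let mk : ∀ v, v ∈ W → vertexSet (convexHull ℝ (W : Set (EuclideanSpace ℝ (Fin n)))) :=
    fun v hv => ⟨v, hvs.symm.subset (Finset.mem_coe.2 hv)⟩
  have hmk : ∀ u v hu hv, mk u hu = mk v hv ↔ u = v := fun u v hu hv => Subtype.ext_iff
  let x₁ := mk q₁ ((hmem _).2 (by simp))
  let x₂ := mk q₂ ((hmem _).2 (by simp))
  let x₃ := mk q₃ ((hmem _).2 (by simp))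
  let x₄ := mk q₄ ((hmem _).2 (by simp))
  let xa := mk a ((hmem _).2 (by simp))
  let xb := mk b ((hmem _).2 (by simp))
  -- The pairs are the two diagonals and the apex `a` is the forbidden vertex, which leaves only `b`
  -- for inner vertices.
  obtain ⟨L, hdisj, havoid⟩ := hlink.2 {x₁, x₂, x₃, x₄, xa} (by
      have : [x₁, x₂, x₃, x₄, xa].Nodup := by
        simp only [x₁, x₂, x₃, x₄, xa, List.nodup_cons, List.mem_cons, hmk, List.not_mem_nil]
        grind
      refine (congrArg Finset.card ?_).trans (List.toFinset_card_of_nodup this)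
      ext
      simp)
    ![x₁, x₂] ![x₃, x₄] (by
      rw [Function.Injective.eq_1]
      simp only [Sum.forall, Fin.forall_fin_two]
      simp [x₁, x₂, x₃, x₄, hmk]
      grind) (by simp [Fin.forall_fin_two]) (by simp [Fin.forall_fin_two])
  have hxa := havoid xa (by simp) (by
    simp only [Fin.forall_fin_two]
    simp [x₁, x₂, x₃, x₄, xa, hmk]
    grind)
  have hcase : ∀ v : vertexSet (convexHull ℝ (W : Set (EuclideanSpace ℝ (Fin n)))),
      v = xb ∨ v = xa ∨ (v = x₁ ∨ v = x₃) ∨ v = x₂ ∨ v = x₄ := fun v => by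
    have := (hmem v.1).1 (hW.mem_of_mem_vertexSet v.2)
    simpa only [Subtype.ext_iff] using this
  obtain ⟨v, hv, hv1, hv3⟩ := exists_mem_support_of_not_adj (u := x₁) (w := x₃)
    (fun h => h13 (congrArg Subtype.val h)) (fun h => hnA ((hW.adj_iff _ _).1 h).2) (L 0).1
  obtain ⟨w, hw, hw2, hw4⟩ := exists_mem_support_of_not_adj (u := x₂) (w := x₄)
    (fun h => h24 (congrArg Subtype.val h)) (fun h => hnB ((hW.adj_iff _ _).1 h).2) (L 1).1
  have hvb : v = xb := by
    rcases hcase v with h | rfl | (h | h) | rfl | rfl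
    · exact h
    · exact absurd hv (hxa 0)
    · exact absurd h hv1
    · exact absurd h hv3
    · exact absurd (L 1).1.start_mem_support (hdisj 0 1 (by simp) _ hv)
    · exact absurd (L 1).1.end_mem_support (hdisj 0 1 (by simp) _ hv)
  have hwb : w = xb := by
    rcases hcase w with h | rfl | (rfl | rfl) | h | h
    · exact h
    · exact absurd hw (hxa 1)
    · exact absurd (L 0).1.start_mem_support (hdisj 1 0 (by simp) _ hw)
    · exact absurd (L 0).1.end_mem_support (hdisj 1 0 (by simp) _ hw)
    · exact absurd h hw2
    · exact absurd h hw4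
  exact hdisj 0 1 (by simp) xb (hvb ▸ hv) (hwb ▸ hw)

end Pyramid

/-! ### A two-fold pyramid over a square in four-space. -/

section Square

variable {n : ℕ}

open Classical in
/-- The vertices of a unit square in a coordinate plane of `ℝ⁴`. -/
noncomputable def squareVertices : Finset (EuclideanSpace ℝ (Fin 4)) :=
  {!₂[0, 0, 0, 0], !₂[1, 0, 0, 0], !₂[0, 1, 0, 0], !₂[1, 1, 0, 0]}

lemma inConvexPosition_squareVertices : InConvexPosition squareVertices := by
  have key : ∀ (v : EuclideanSpace ℝ (Fin 4)) (a b c : ℝ), v ∈ squareVertices →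
      a * v 0 + b * v 1 = c → (∀ w ∈ squareVertices, w ≠ v → a * w 0 + b * w 1 < c) →
      IsExposedSubset squareVertices {v} := fun v a b c hv hc h => by
    refine ⟨Finset.singleton_subset_iff.2 hv, a • EuclideanSpace.proj 0 + b • EuclideanSpace.proj 1,
      c, by simpa using hc, fun w hw hwv => by simpa using h w hw (by simpa using hwv)⟩
  intro v hv
  have hv' := hv
  simp only [squareVertices, Finset.mem_insert, Finset.mem_singleton] at hv'
  rcases hv' with rfl | rfl | rfl | rfl
  -- The coefficients point diagonally outwards at each corner.
  · exact key _ (-1) (-1) 0 hv (by simp) (by norm_num [squareVertices])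
  · exact key _ 1 (-1) 1 hv (by simp) (by norm_num [squareVertices])
  · exact key _ (-1) 1 1 hv (by simp) (by norm_num [squareVertices])
  · exact key _ 1 1 2 hv (by norm_num) (by norm_num [squareVertices])

lemma card_squareVertices : squareVertices.card = 4 := by
  simp [squareVertices, Finset.card_insert_of_notMem]

lemma vectorSpan_parallelogram {V : Set (EuclideanSpace ℝ (Fin n))}
    {o u w : EuclideanSpace ℝ (Fin n)} (ho : o ∈ V) (hu : u ∈ V) (hw : w ∈ V)
    (h : ∀ v ∈ V, v = o ∨ v = u ∨ v = w ∨ v - o = (u - o) + (w - o)) :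
    vectorSpan ℝ V = Submodule.span ℝ (Set.range ![u - o, w - o]) := by
  refine le_antisymm ?_ (span_le_vectorSpan ho hu hw)
  rw [vectorSpan_eq_span_vsub_set_right ℝ ho, Submodule.span_le]
  have hspan : ∀ i, ![u - o, w - o] i ∈ Submodule.span ℝ (Set.range ![u - o, w - o]) :=
    fun i => Submodule.subset_span ⟨i, rfl⟩
  rintro _ ⟨v, hv, rfl⟩
  change v - o ∈ Submodule.span ℝ (Set.range ![u - o, w - o])
  rcases h v hv with rfl | rfl | rfl | h
  · rw [sub_self]
    exact Submodule.zero_mem _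
  · exact hspan 0
  · exact hspan 1
  · rw [h]
    exact Submodule.add_mem _ (hspan 0) (hspan 1)

lemma finrank_vectorSpan_squareVertices :
    Module.finrank ℝ (vectorSpan ℝ (squareVertices : Set (EuclideanSpace ℝ (Fin 4)))) = 2 := by
  have h0 : !₂[(0 : ℝ), 0, 0, 0] ∈ squareVertices := by simp [squareVertices]
  have h1 : !₂[(1 : ℝ), 0, 0, 0] ∈ squareVertices := by simp [squareVertices]
  have h2 : !₂[(0 : ℝ), 1, 0, 0] ∈ squareVertices := by simp [squareVertices]
  have hli := inConvexPosition_squareVertices.linearIndependent_sub h0 h1 h2 (by simp) (by simp)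
    (by simp)
  rw [vectorSpan_parallelogram (Finset.mem_coe.2 h0) (Finset.mem_coe.2 h1) (Finset.mem_coe.2 h2),
    finrank_span_eq_card hli, Fintype.card_fin]
  intro v hv
  simp only [squareVertices, Finset.mem_coe, Finset.mem_insert, Finset.mem_singleton] at hv
  refine hv.imp_right (Or.imp_right (Or.imp_right ?_))
  rintro rfl
  ext i
  fin_cases i <;> simp

theorem exists_twoFoldPyramid :
    ∃ P Q : Set (EuclideanSpace ℝ (Fin 4)), IsQuadrangle Q ∧ IsTwoFoldPyramid P Q := by
  have hne : squareVertices.Nonempty := ⟨!₂[0, 0, 0, 0], by simp [squareVertices]⟩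
  -- The last two coordinates vanish on the square, so the last two basis vectors can be the apexes;
  -- the final coordinate vanishes on the first apex too.
  have hflat : ∀ i : Fin 4, 2 ≤ i → ∀ v ∈ squareVertices, (EuclideanSpace.proj i :
      EuclideanSpace ℝ (Fin 4) →L[ℝ] ℝ) v = 0 := by
    intro i hi v hv
    simp only [squareVertices, Finset.mem_insert, Finset.mem_singleton] at hv
    rcases hv with rfl | rfl | rfl | rfl <;> fin_cases i <;> simp at hi ⊢
  refine ⟨_, convexHull ℝ squareVertices, ⟨isDPolytope_convexHull hne
    finrank_vectorSpan_squareVertices, ?_⟩, _, ⟨!₂[0, 0, 1, 0], fun h => ?_, rfl⟩,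
    ⟨!₂[0, 0, 0, 1], fun h => ?_, rfl⟩⟩
  · rw [inConvexPosition_squareVertices.vertexSet_eq, Set.encard_coe_eq_coe_finsetCard,
      card_squareVertices]
    rfl
  · rw [affineSpan_convexHull] at h
    have := eq_of_mem_affineSpan (hflat 2 le_rfl) h
    simp at this
  · rw [affineSpan_convexHull] at h
    have := eq_of_mem_affineSpan (l := EuclideanSpace.proj 3) (c := 0) (fun v hv => ?_) h
    · simp at this
    · rcases hv with rfl | hv
      · simp
      · exact eq_of_mem_convexHull (hflat 3 (by decide)) hv

end Square

end CubicalPolytope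

theorem mainTheorem9 :
    (∀ (n : ℕ) (P : Set (EuclideanSpace ℝ (Fin n))),
      CubicalPolytope.IsCubicalDPolytope 4 P → CubicalPolytope.IsStronglyLinked 4 2 P) ∧
    (∀ (n : ℕ) (P Q : Set (EuclideanSpace ℝ (Fin n))),
      CubicalPolytope.IsQuadrangle Q → CubicalPolytope.IsTwoFoldPyramid P Q →
        CubicalPolytope.IsDPolytope 4 P ∧ (CubicalPolytope.vertexSet P).encard = 6 ∧
          ¬ CubicalPolytope.IsStronglyLinked 4 2 P) ∧
    (∃ P Q : Set (EuclideanSpace ℝ (Fin 4)),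
      CubicalPolytope.IsQuadrangle Q ∧ CubicalPolytope.IsTwoFoldPyramid P Q) := by
  exact ⟨fun _ _ hP => CubicalPolytope.isStronglyLinked_of_cubical hP,
    fun _ _ _ hQ hP => CubicalPolytope.IsTwoFoldPyramid.not_isStronglyLinked hQ hP,
    CubicalPolytope.exists_twoFoldPyramid⟩
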